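/- Conventions. A topos is an elementary topos: a category with finite limits, exponentials and a subobject classifier. A Cartesian comonad on a topos is a comonad $(\Box,\varepsilon,\delta)$ whose underlying functor preserves finite limits; $\mathrm{Coalg}(\Box)$ denotes its category of coalgebras. A logical inclusion of toposes $i:\mathcal{E}\hookrightarrow\mathcal{F}$ is a full subcategory inclusion (a functor that is full, faithful and injective on objects) which preserves finite limits, exponentials and the subobject classifier. The coverage on $\mathcal{F}$ induced by $i$ is the Grothendieck topology $J_\mathcal{E}$ in which a sieve on $X$ is covering if and only if it contains every morphism $iA\to X$ with $A\in\mathcal{E}$. The self-indexing $\mathcal{F}/(-)$ is the pseudofunctor that sends $X$ to the slice category $\mathcal{F}/X$ and acts on morphisms by pullback. The logical inclusion $i$ is dense if 1. $\mathcal{E}$ is a dense subcategory of $\mathcal{F}$, i.e. every $X\in\mathcal{F}$ is the colimit of the canonical diagram $(i\downarrow X)\to\mathcal{E}\xrightarrow{i}\mathcal{F}$; and 2. $\mathcal{F}/(-)$ is a stack for $J_\mathcal{E}$. Let $\Box_\mathcal{E}$ and $\Box_\mathcal{F}$ be Cartesian comonads on toposes $\mathcal{E}$ and $\mathcal{F}$.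 A dense logical inclusion $\Box_\mathcal{E}\hookrightarrow\Box_\mathcal{F}$ consists of a dense logical inclusion $i:\mathcal{E}\hookrightarrow\mathcal{F}$ together with a natural isomorphism $\tau:i\,\Box_\mathcal{E}\cong\Box_\mathcal{F}\,i$ (for example an identity, when $i$ commutes strictly with the comonad structures) that is compatible with the counits and comultiplications, i.e. $(\varepsilon_\mathcal{F}i)\circ\tau=i\varepsilon_\mathcal{E}$ and $(\delta_\mathcal{F}i)\circ\tau=(\Box_\mathcal{F}\tau)\circ(\tau\Box_\mathcal{E})\circ(i\delta_\mathcal{E})$, such that $\Box_\mathcal{F}$ is a morphism of sites $(\mathcal{F},\mathcal{E})\to(\mathcal{F},\mathcal{E})$: for all $X\in\mathcal{F}$ and $A\in\mathcal{E}$, every $f:iA\to\Box_\mathcal{F}X$ factors through $\Box_\mathcal{F}g$ for some $B\in\mathcal{E}$ and some $g:iB\to X$. Statement. Let $\Box_\mathcal{E}\hookrightarrow\Box_\mathcal{F}$ be a dense logical inclusion of Cartesian comonads on toposes. Then $\mathrm{Coalg}(\Box_\mathcal{E})$ and $\mathrm{Coalg}(\Box_\mathcal{F})$ are toposes, and the induced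 functor $$\mathrm{Coalg}(i):\mathrm{Coalg}(\Box_\mathcal{E})\to\mathrm{Coalg}(\Box_\mathcal{F}),\qquad (A,a)\mapsto(iA,\ \tau_A\circ i(a)),$$ is a dense logical inclusion of toposes. That is, $\mathrm{Coalg}(i)$ is a logical inclusion, $\mathrm{Coalg}(\Box_\mathcal{E})$ is a dense subcategory of $\mathrm{Coalg}(\Box_\mathcal{F})$, and the self-indexing $\mathrm{Coalg}(\Box_\mathcal{F})/(-)$ is a stack for the coverage induced by $\mathrm{Coalg}(\Box_\mathcal{E})$. -/

import Mathlib

open CategoryTheory Limits Opposite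

universe v u v₁ v₂ v₃ v₄ u₁ u₂ u₃ u₄

namespace StratTopos

noncomputable section SelfIndexing

variable {C : Type u} [Category.{v} C] [HasPullbacks C]

/-- The base change functor `f^* : Over Y ⥤ Over X`. -/
def baseChange {X Y : C} (f : X ⟶ Y) : Over Y ⥤ Over X := Over.pullback f

/-- The projection `f^* W ⟶ W`. -/
def baseChangeFst {X Y : C} (f : X ⟶ Y) (W : Over Y) :
    ((baseChange f).obj W).left ⟶ W.left :=
  pullback.fst W.hom f

lemma baseChangeFst_w {X Y : C} (f : X ⟶ Y) (W : Over Y) :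
    baseChangeFst f W ≫ W.hom = ((baseChange f).obj W).hom ≫ f :=
  pullback.condition

lemma baseChangeFst_w_assoc {X Y : C} (f : X ⟶ Y) (W : Over Y) {T : C} (t : Y ⟶ T) :
    baseChangeFst f W ≫ W.hom ≫ t = ((baseChange f).obj W).hom ≫ f ≫ t := by
  rw [← Category.assoc, baseChangeFst_w, Category.assoc]

lemma baseChange_hom_ext {X Y : C} {f : X ⟶ Y} {W : Over Y} {T : Over X}
    {a b : T ⟶ (baseChange f).obj W}
    (h : a.left ≫ baseChangeFst f W = b.left ≫ baseChangeFst f W) : a = b := by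
  ext
  exact pullback.hom_ext h ((Over.w a).trans (Over.w b).symm)

/-- The morphism `T ⟶ f^* W` over `X` induced by a morphism `T ⟶ W` over `f : X ⟶ Y`. -/
def baseChangeLift {X Y : C} {f : X ⟶ Y} {W : Over Y} {T : Over X} (a : T.left ⟶ W.left)
    (h : a ≫ W.hom = T.hom ≫ f) : T ⟶ (baseChange f).obj W :=
  Over.homMk (pullback.lift a T.hom h) (pullback.lift_snd _ _ _)

@[simp]
lemma baseChangeLift_left_fst {X Y : C} {f : X ⟶ Y} {W : Over Y} {T : Over X}
    (a : T.left ⟶ W.left) (h : a ≫ W.hom = T.hom ≫ f) :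
    (baseChangeLift a h).left ≫ baseChangeFst f W = a :=
  pullback.lift_fst _ _ _

@[simp]
lemma baseChangeLift_left_fst_assoc {X Y : C} {f : X ⟶ Y} {W : Over Y} {T : Over X}
    (a : T.left ⟶ W.left) (h : a ≫ W.hom = T.hom ≫ f) {S : C} (t : W.left ⟶ S) :
    (baseChangeLift a h).left ≫ baseChangeFst f W ≫ t = a ≫ t := by
  rw [← Category.assoc, baseChangeLift_left_fst]

@[simp]
lemma baseChange_map_left_fst {X Y : C} (f : X ⟶ Y) {W W' : Over Y} (k : W ⟶ W') :
    ((baseChange f).map k).left ≫ baseChangeFst f W' = baseChangeFst f W ≫ k.left :=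
  pullback.lift_fst _ _ _

@[simp]
lemma baseChange_map_left_fst_assoc {X Y : C} (f : X ⟶ Y) {W W' : Over Y} (k : W ⟶ W') {S : C}
    (t : W'.left ⟶ S) :
    ((baseChange f).map k).left ≫ baseChangeFst f W' ≫ t =
      baseChangeFst f W ≫ k.left ≫ t := by
  rw [← Category.assoc, baseChange_map_left_fst, Category.assoc]

/-- The canonical isomorphism `(𝟙 X)^* ≅ 𝟭`, with components the first projections. -/
def baseChangeId (X : C) : baseChange (𝟙 X) ≅ 𝟭 (Over X) :=
  NatIso.ofComponents
    (fun Z =>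
      { hom := Over.homMk (baseChangeFst (𝟙 X) Z) (by simp [baseChangeFst_w])
        inv := baseChangeLift (𝟙 _) (by simp)
        hom_inv_id := baseChange_hom_ext (by simp)
        inv_hom_id := by ext; simp })
    (fun f => by ext; simp)

@[simp]
lemma baseChangeId_hom_app_left {X : C} (Z : Over X) :
    ((baseChangeId X).hom.app Z).left = baseChangeFst (𝟙 X) Z := rfl

/-- The canonical isomorphism `(f ≫ g)^* ≅ f^* ∘ g^*`. -/
def baseChangeComp {X Y Z : C} (f : X ⟶ Y) (g : Y ⟶ Z) :
    baseChange (f ≫ g) ≅ baseChange g ⋙ baseChange f :=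
  NatIso.ofComponents
    (fun W =>
      { hom := baseChangeLift (baseChangeLift (T := (Over.map f).obj
            ((baseChange (f ≫ g)).obj W)) (baseChangeFst (f ≫ g) W)
            (by simp [baseChangeFst_w])).left (Over.w _)
        inv := baseChangeLift (baseChangeFst f _ ≫ baseChangeFst g W)
            (by simp [baseChangeFst_w, baseChangeFst_w_assoc])
        hom_inv_id := baseChange_hom_ext (by simp)
        inv_hom_id := by
          refine baseChange_hom_ext ?_
          have : ∀ {T : Over X} (a b : T.left ⟶ ((baseChange g).obj W).left)
              (_ : a ≫ ((baseChange g).obj W).hom = b ≫ ((baseChange g).obj W).hom)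
              (_ : a ≫ baseChangeFst g W = b ≫ baseChangeFst g W), a = b :=
            fun a b h h' => pullback.hom_ext h' h
          apply this
          · simp [baseChangeFst_w]
          · simp })
    (fun {W W'} k => by
      refine baseChange_hom_ext ?_
      apply pullback.hom_ext
      · change (_ ≫ _) ≫ baseChangeFst g W' = (_ ≫ _) ≫ baseChangeFst g W'
        simp
      · change (_ ≫ _) ≫ ((baseChange g).obj W').hom = (_ ≫ _) ≫ ((baseChange g).obj W').hom
        simp)

@[simp]
lemma baseChangeComp_hom_app_left_fst_fst {X Y Z : C} (f : X ⟶ Y) (g : Y ⟶ Z) (W : Over Z) :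
    ((baseChangeComp f g).hom.app W).left ≫ baseChangeFst f _ ≫ baseChangeFst g W =
      baseChangeFst (f ≫ g) W := by
  simp [baseChangeComp]

@[simp]
lemma baseChangeComp_hom_app_left_fst_fst_assoc {X Y Z : C} (f : X ⟶ Y) (g : Y ⟶ Z) (W : Over Z)
    {S : C} (t : W.left ⟶ S) :
    ((baseChangeComp f g).hom.app W).left ≫ baseChangeFst f _ ≫ baseChangeFst g W ≫ t =
      baseChangeFst (f ≫ g) W ≫ t := by
  simp [baseChangeComp]

@[simp]
lemma baseChangeComp_inv_app_left_fst {X Y Z : C} (f : X ⟶ Y) (g : Y ⟶ Z) (W : Over Z) :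
    ((baseChangeComp f g).inv.app W).left ≫ baseChangeFst (f ≫ g) W =
      baseChangeFst f _ ≫ baseChangeFst g W := by
  simp [baseChangeComp]

@[simp]
lemma baseChangeComp_inv_app_left_fst_assoc {X Y Z : C} (f : X ⟶ Y) (g : Y ⟶ Z) (W : Over Z)
    {S : C} (t : W.left ⟶ S) :
    ((baseChangeComp f g).inv.app W).left ≫ baseChangeFst (f ≫ g) W ≫ t =
      baseChangeFst f _ ≫ baseChangeFst g W ≫ t := by
  simp [baseChangeComp]

lemma eqToHom_baseChange_fst {X Y : C} {f g : X ⟶ Y} (h : f = g) (W : Over Y)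
    (h' : (baseChange f).obj W = (baseChange g).obj W) :
    (eqToHom h').left ≫ baseChangeFst g W = baseChangeFst f W := by
  subst h
  simp

lemma eqToHom_toNatTrans_app {X Y : Cat.{v, u}} {F G : X ⟶ Y} (h : F = G) (Z : X) :
    (eqToHom h).toNatTrans.app Z = eqToHom (by rw [h]) := by
  subst h
  simp


lemma baseChange_associator {W X Y Z : C} (h : W ⟶ X) (g : X ⟶ Y) (f : Y ⟶ Z) (A : Over Z) :
    ((baseChangeComp h (g ≫ f)).hom.app A ≫ (baseChange h).map ((baseChangeComp g f).hom.app A) ≫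
      𝟙 _ ≫ (baseChangeComp h g).inv.app ((baseChange f).obj A) ≫
        (baseChangeComp (h ≫ g) f).inv.app A).left ≫ baseChangeFst ((h ≫ g) ≫ f) A =
    baseChangeFst (h ≫ g ≫ f) A := by
  have h₁ := baseChangeComp_inv_app_left_fst_assoc h g ((baseChange f).obj A) (baseChangeFst f A)
  have h₂ := baseChange_map_left_fst_assoc h ((baseChangeComp g f).hom.app A)
    (baseChangeFst g _ ≫ baseChangeFst f A)
  simp only [Functor.comp_obj, Over.comp_left, Category.assoc, baseChangeComp_inv_app_left_fst,
    Category.id_comp, Functor.comp_obj] at h₁ h₂ ⊢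
  erw [h₁, h₂]
  simp

lemma baseChange_leftUnitor {X Y : C} (f : X ⟶ Y) (A : Over Y) :
    ((baseChangeComp f (𝟙 Y)).hom.app A ≫
      (baseChange f).map ((baseChangeId Y).hom.app A) ≫ 𝟙 _).left ≫
      baseChangeFst f A = baseChangeFst (f ≫ 𝟙 Y) A := by
  simp

lemma baseChange_rightUnitor {X Y : C} (f : X ⟶ Y) (A : Over Y) :
    ((baseChangeComp (𝟙 X) f).hom.app A ≫
      (baseChangeId X).hom.app ((baseChange f).obj A) ≫ 𝟙 _).left ≫
      baseChangeFst f A = baseChangeFst (𝟙 X ≫ f) A := by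
  simp

/-- The self-indexing `C/(-)` of a category with pullbacks: it sends `X` to the slice category
`Over X`, and a morphism `f` to the base change functor `f^*`. -/
def selfIndexing (C : Type u) [Category.{v} C] [HasPullbacks C] :
    Pseudofunctor (LocallyDiscrete Cᵒᵖ) Cat.{v, max u v} :=
  LocallyDiscrete.mkPseudofunctor
    (fun X => Cat.of (Over X.unop))
    (fun f => (baseChange f.unop).toCatHom)
    (fun X => Cat.Hom.isoMk (baseChangeId X.unop))
    (fun f g => Cat.Hom.isoMk (baseChangeComp g.unop f.unop))
    (by
      intro X Y Z W f g h
      ext A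
      rw [eqToHom_toNatTrans_app]
      refine baseChange_hom_ext (Eq.trans ?_ (eqToHom_baseChange_fst (by simp) A _).symm)
      exact baseChange_associator h.unop g.unop f.unop A)
    (by
      intro X Y f
      ext A
      rw [eqToHom_toNatTrans_app]
      refine baseChange_hom_ext (Eq.trans ?_ (eqToHom_baseChange_fst (by simp) A _).symm)
      exact baseChange_leftUnitor f.unop A)
    (by
      intro X Y f
      ext A
      rw [eqToHom_toNatTrans_app]
      refine baseChange_hom_ext (Eq.trans ?_ (eqToHom_baseChange_fst (by simp) A _).symm)
      exact baseChange_rightUnitor f.unop A)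

end SelfIndexing

section Sites

variable {C : Type u₁} [Category.{v₁} C] {D : Type u₂} [Category.{v₂} D]

/-- The coverage on `D` induced by a full subcategory inclusion `i : C ⥤ D`: a sieve on `X` is
covering if and only if it contains all morphisms `i.obj A ⟶ X`. -/
def inducedTopology (i : C ⥤ D) : GrothendieckTopology D where
  sieves X := {S | ∀ (A : C) (f : i.obj A ⟶ X), S f}
  top_mem' _ _ _ := trivial
  pullback_stable' _ _ _ g hS A f := hS A (f ≫ g)
  transitive' _ S hS R hR A f := by
    simpa using hR (hS A f) A (𝟙 _)

lemma mem_inducedTopology_iff (i : C ⥤ D) {X : D} (S : Sieve X) :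
    S ∈ inducedTopology i X ↔ ∀ (A : C) (f : i.obj A ⟶ X), S f := Iff.rfl

variable {C' : Type u₃} [Category.{v₃} C'] {D' : Type u₄} [Category.{v₄} D']

/-- `G : D ⥤ D'` is a morphism of sites `(D, C) ⟶ (D', C')`, for `i : C ⥤ D` and `j : C' ⥤ D'`:
every morphism `f : j.obj A ⟶ G.obj X` factors through `G.map g` for some `g : i.obj B ⟶ X`. -/
def IsMorphismOfSites (i : C ⥤ D) (j : C' ⥤ D') (G : D ⥤ D') : Prop :=
  ∀ (X : D) (A : C') (f : j.obj A ⟶ G.obj X),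
    ∃ (B : C) (g : i.obj B ⟶ X) (h : j.obj A ⟶ G.obj (i.obj B)), h ≫ G.map g = f

end Sites

section Toposes

/-- `ev : A ⨯ X ⟶ B` exhibits `X` as the exponential `B ^ A`. -/
def IsExponential {C : Type u} [Category.{v} C] [HasBinaryProducts C] {A X B : C}
    (ev : A ⨯ X ⟶ B) : Prop :=
  ∀ (Z : C) (f : A ⨯ Z ⟶ B), ∃! g : Z ⟶ X, prod.map (𝟙 A) g ≫ ev = f

/-- Elementary toposes: finite limits, exponentials and a subobject classifier. -/
class IsElementaryTopos (C : Type u) [Category.{v} C] : Prop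
    extends HasFiniteLimits C, HasSubobjectClassifier C where
  exists_exponential : ∀ A B : C, ∃ (X : C) (ev : A ⨯ X ⟶ B), IsExponential ev

variable {E : Type u₁} [Category.{v₁} E] {F : Type u₂} [Category.{v₂} F]

/-- Logical inclusions of toposes: full subcategory inclusions which preserve finite limits,
exponentials (with their evaluation maps) and the subobject classifier. -/
structure IsLogicalInclusion [IsElementaryTopos E] [IsElementaryTopos F] (i : E ⥤ F) : Prop where
  full : i.Full
  faithful : i.Faithful
  injective_obj : Function.Injective i.obj
  preservesFiniteLimits : PreservesFiniteLimits i
  isExponential : ∀ {A X B : E} (ev : A ⨯ X ⟶ B), IsExponential ev →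
    ∀ ev' : i.obj A ⨯ i.obj X ⟶ i.obj B, prodComparison i A X ≫ ev' = i.map ev →
      IsExponential ev'
  classifier : ∀ c : Subobject.Classifier E, ∃ c' : Subobject.Classifier F,
    Nonempty (Arrow.mk (i.map c.truth) ≅ Arrow.mk c'.truth)

/-- Dense logical inclusions of toposes: `E` is a dense subcategory of `F`, and the self-indexing
of `F` is a stack for the coverage induced by `E`. -/
structure IsDenseLogicalInclusion [IsElementaryTopos E] [IsElementaryTopos F] (i : E ⥤ F) : Prop
    extends IsLogicalInclusion i where
  isDense : i.IsDense
  isStack : (selfIndexing F).IsStack (inducedTopology i)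

end Toposes

section Comonads

variable {E : Type u₁} [Category.{v₁} E] {F : Type u₂} [Category.{v₂} F]

/-- A structure of (strong) morphism of comonads `G ⟶ H` on a functor `i`. A strict morphism is the
case where the components of `τ` are identities, i.e. `i` commutes on the nose with the functors,
the counits and the comultiplications. -/
structure ComonadMorphism (i : E ⥤ F) (G : Comonad E) (H : Comonad F) where
  τ : G.toFunctor ⋙ i ≅ i ⋙ H.toFunctor
  counit : ∀ X : E, τ.hom.app X ≫ H.ε.app (i.obj X) = i.map (G.ε.app X)
  comult : ∀ X : E, τ.hom.app X ≫ H.δ.app (i.obj X) =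
    i.map (G.δ.app X) ≫ τ.hom.app (G.obj X) ≫ H.map (τ.hom.app X)

/-- The functor `Coalg(i) : Coalg(G) ⥤ Coalg(H)` induced by a morphism of comonads. -/
@[simps]
def ComonadMorphism.coalg {i : E ⥤ F} {G : Comonad E} {H : Comonad F}
    (φ : ComonadMorphism i G H) : G.Coalgebra ⥤ H.Coalgebra where
  obj X :=
    { A := i.obj X.A
      a := i.map X.a ≫ φ.τ.hom.app X.A
      counit := by
        rw [Category.assoc, φ.counit, ← i.map_comp, X.counit, i.map_id]
      coassoc := by
        have h := φ.τ.hom.naturality X.a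
        dsimp only [Functor.comp_obj, Functor.comp_map] at h
        rw [Category.assoc, φ.comult, ← i.map_comp_assoc, X.coassoc, i.map_comp_assoc,
          reassoc_of% h, H.map_comp, Category.assoc] }
  map f :=
    { f := i.map f.f
      h := by
        have h := φ.τ.hom.naturality f.f
        dsimp only [Functor.comp_obj, Functor.comp_map] at h ⊢
        rw [Category.assoc, ← h, ← i.map_comp_assoc, f.h, i.map_comp_assoc] }
  map_id X := by
    ext
    exact i.map_id _
  map_comp f g := by
    ext
    exact i.map_comp _ _

/-- Dense logical inclusions of Cartesian comonads on toposes. -/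
structure IsDenseLogicalComonadInclusion [IsElementaryTopos E] [IsElementaryTopos F] {i : E ⥤ F}
    {G : Comonad E} {H : Comonad F} (φ : ComonadMorphism i G H) : Prop where
  cartesian_source : PreservesFiniteLimits G.toFunctor
  cartesian_target : PreservesFiniteLimits H.toFunctor
  isDenseLogicalInclusion : IsDenseLogicalInclusion i
  isMorphismOfSites : IsMorphismOfSites i i H.toFunctor

end Comonads

end StratTopos

namespace StratTopos

/-! ### Gluing morphisms along covers of a subcanonical topology -/

section Glue

universe t

variable {C : Type u} [Category.{v} C] {J : GrothendieckTopology C}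

/-! Call a morphism `i.obj A ⟶ X` a point of `X`. Density makes the induced topology subcanonical,
so morphisms out of `X` are determined by their values on points and can be glued from compatible
values.

The crux is that every point `f` of the underlying object of a coalgebra `X` factors through a
coalgebra morphism from an object of `Coalg(G)` (`exists_factorization`). The site condition makes
`f ≫ X.a` pass through `H.map g` for some `g : i.obj B ⟶ X.A`. Since `H i ≅ i G`, the cofree
coalgebra on `i.obj B` comes from `E`. Its pullback along the embedding `X.a` of `X` into a cofree
coalgebra is a subobject of it, and `f` factors through this pullback. Logicality of `i` puts
subobjects of objects of `E` back into `E`, and the same holds for coalgebras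
(`subobjectClosed_coalg`), so the pullback comes from `Coalg(G)`.

Hence forgetting coalgebra structures sends covers to covers (`ofArrows_f_mem`), and density and
descent reduce to gluing in `F`. For descent, a datum of coalgebras forgets to a datum in `F`, whose
glued object `W` receives a coalgebra structure because morphisms out of `W` glue
(`isEffective_of_forget`); `H` need not preserve colimits. Descent data are handled as transports of
generalized elements, which hides the coherence isomorphisms of iterated pullbacks.

Coalgebras form a topos by adjoint lifting and by cutting a classifier out of the cofree coalgebra
on `Ω`. Logicality of `Coalg(i)` is then formal: exponentials and classifiers of a dense full
subcategory, closed under finite limits and (for the classifier) subobjects, keep their universal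
property when tested on points (`isExponential_map`, `exists_classifier`). -/

lemma isSheafFor_ofArrows [J.Subcanonical] {ι : Type t} {X : C} {Z : ι → C} (f : ∀ i, Z i ⟶ X)
    (hf : Sieve.ofArrows Z f ∈ J X) (T : C) :
    Presieve.IsSheafFor (yoneda.obj T) (Presieve.ofArrows Z f) := by
  exact Presieve.IsSheaf.isSheafFor
    (GrothendieckTopology.Subcanonical.isSheaf_of_isRepresentable (yoneda.obj T)) _ hf

/-- Morphisms glue along covering families of a subcanonical topology. -/
lemma exists_glue [J.Subcanonical] {ι : Type t} {X : C} {Z : ι → C} (f : ∀ i, Z i ⟶ X)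
    (hf : Sieve.ofArrows Z f ∈ J X) {T : C} (k : ∀ i, Z i ⟶ T)
    (hk : ∀ {W : C} {i j : ι} (a : W ⟶ Z i) (b : W ⟶ Z j), a ≫ f i = b ≫ f j →
      a ≫ k i = b ≫ k j) : ∃ g : X ⟶ T, ∀ i, f i ≫ g = k i := by
  obtain ⟨g, hg, -⟩ := (Presieve.isSheafFor_arrows_iff _ _).1 (isSheafFor_ofArrows f hf T) k
    (fun i j W a b h => hk a b h)
  exact ⟨g, hg⟩

/-- Covering families of a subcanonical topology are jointly epimorphic. -/
lemma hom_ext_of_cover [J.Subcanonical] {ι : Type t} {X : C} {Z : ι → C} (f : ∀ i, Z i ⟶ X)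
    (hf : Sieve.ofArrows Z f ∈ J X) {T : C} {g g' : X ⟶ T} (h : ∀ i, f i ≫ g = f i ≫ g') :
    g = g' := by
  refine (isSheafFor_ofArrows f hf T).isSeparatedFor.ext ?_
  rintro _ _ ⟨i⟩
  exact h i

lemma baseChange_mem_topology {ι : Type t} {X Y : C} (p : Y ⟶ X) {Z Z' : ι → C}
    {f : ∀ i, Z i ⟶ X} (hf : Sieve.ofArrows Z f ∈ J X) {f' : ∀ i, Z' i ⟶ Y}
    {p' : ∀ i, Z' i ⟶ Z i} (h : ∀ i, IsPullback (f' i) (p' i) p (f i)) :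
    Sieve.ofArrows Z' f' ∈ J Y := by
  refine J.superset_covering ?_ (J.pullback_stable p hf)
  rintro W a ⟨_, b, _, ⟨i⟩, hb⟩
  exact ⟨_, (h i).lift a b hb.symm, _, ⟨i⟩, (h i).lift_fst _ _ _⟩

end Glue

/-! ### Descent for slice categories via generalized elements -/

noncomputable section Descent

universe t

variable {C : Type u} [Category.{v} C]

/-- A descent datum for slice categories along a family `f i : Z i ⟶ X`, in terms of generalized
elements: objects `Y i` over `Z i`, and a transport of the elements of `Y i` to `Y j`. -/
structure OverDescent {ι : Type t} {X : C} {Z : ι → C} (f : ∀ i, Z i ⟶ X) where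
  Y : ι → C
  p : ∀ i, Y i ⟶ Z i
  tr : ∀ {T : C} {i j : ι} (y : T ⟶ Y i) (z : T ⟶ Z j), y ≫ p i ≫ f i = z ≫ f j → (T ⟶ Y j)
  tr_p : ∀ {T : C} {i j : ι} (y : T ⟶ Y i) (z : T ⟶ Z j) (h : y ≫ p i ≫ f i = z ≫ f j),
    tr y z h ≫ p j = z
  comp_tr : ∀ {T T' : C} {i j : ι} (g : T' ⟶ T) (y : T ⟶ Y i) (z : T ⟶ Z j)
    (h : y ≫ p i ≫ f i = z ≫ f j),
    g ≫ tr y z h = tr (g ≫ y) (g ≫ z) (by rw [Category.assoc, h, Category.assoc])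
  tr_self : ∀ {T : C} {i : ι} (y : T ⟶ Y i), tr y (y ≫ p i) (Category.assoc _ _ _).symm = y
  tr_tr : ∀ {T : C} {i j k : ι} (y : T ⟶ Y i) (z : T ⟶ Z j) (z' : T ⟶ Z k)
    (h : y ≫ p i ≫ f i = z ≫ f j) (h' : z ≫ f j = z' ≫ f k),
    tr (tr y z h) z' (by rw [← Category.assoc, tr_p, h']) = tr y z' (h.trans h')

namespace OverDescent

variable {ι : Type t} {X : C} {Z : ι → C} {f : ∀ i, Z i ⟶ X}

/-- A descent datum is effective if it is obtained by base change from an object over `X`. -/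
def IsEffective (D : OverDescent f) : Prop :=
  ∃ (W : C) (q : W ⟶ X) (e : ∀ i, D.Y i ⟶ W), (∀ i, IsPullback (e i) (D.p i) q (f i)) ∧
    ∀ {T : C} {i j : ι} (y : T ⟶ D.Y i) (z : T ⟶ Z j) (h : y ≫ D.p i ≫ f i = z ≫ f j),
      D.tr y z h ≫ e j = y ≫ e i

lemma tr_congr (D : OverDescent f) {T : C} {i j : ι} {y y' : T ⟶ D.Y i} {z z' : T ⟶ Z j}
    (hy : y = y') (hz : z = z') (h : y ≫ D.p i ≫ f i = z ≫ f j) :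
    D.tr y z h = D.tr y' z' (by rw [← hy, ← hz, h]) := by
  subst hy hz
  rfl

end OverDescent

variable [HasPullbacks C]

open Pseudofunctor LocallyDiscreteOpToCat

/-- The base change of `M` along `k = g ≫ f` compares to the iterated base change. -/
def selfIndexingCompHom {X Y Z : C} (f : Y ⟶ X) (g : Z ⟶ Y) (k : Z ⟶ X)
    (h' : f.op.toLoc ≫ g.op.toLoc = k.op.toLoc) (M : Over X) :
    (baseChange k).obj M ⟶ (baseChange g).obj ((baseChange f).obj M) :=
  ((selfIndexing C).mapComp' f.op.toLoc g.op.toLoc k.op.toLoc h').hom.toNatTrans.app M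

/-- The iterated base change of `M` compares to the base change along `k = g ≫ f`. -/
def selfIndexingCompInv {X Y Z : C} (f : Y ⟶ X) (g : Z ⟶ Y) (k : Z ⟶ X)
    (h' : f.op.toLoc ≫ g.op.toLoc = k.op.toLoc) (M : Over X) :
    (baseChange g).obj ((baseChange f).obj M) ⟶ (baseChange k).obj M :=
  ((selfIndexing C).mapComp' f.op.toLoc g.op.toLoc k.op.toLoc h').inv.toNatTrans.app M

lemma selfIndexingCompHom_eq {X Y Z : C} (f : Y ⟶ X) (g : Z ⟶ Y)
    (h' : f.op.toLoc ≫ g.op.toLoc = (g ≫ f).op.toLoc) (M : Over X) :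
    selfIndexingCompHom f g (g ≫ f) h' M = (baseChangeComp g f).hom.app M := by
  have := Pseudofunctor.mapComp'_eq_mapComp (selfIndexing C) f.op.toLoc g.op.toLoc
  exact congr_arg (fun α => α.hom.toNatTrans.app M) this

lemma selfIndexingCompInv_eq {X Y Z : C} (f : Y ⟶ X) (g : Z ⟶ Y)
    (h' : f.op.toLoc ≫ g.op.toLoc = (g ≫ f).op.toLoc) (M : Over X) :
    selfIndexingCompInv f g (g ≫ f) h' M = (baseChangeComp g f).inv.app M := by
  have := Pseudofunctor.mapComp'_eq_mapComp (selfIndexing C) f.op.toLoc g.op.toLoc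
  exact congr_arg (fun α => α.inv.toNatTrans.app M) this

lemma selfIndexingCompHom_fst {X Y Z : C} (f : Y ⟶ X) (g : Z ⟶ Y) (k : Z ⟶ X)
    (h' : f.op.toLoc ≫ g.op.toLoc = k.op.toLoc) (M : Over X) :
    (selfIndexingCompHom f g k h' M).left ≫ baseChangeFst g ((baseChange f).obj M) ≫
      baseChangeFst f M = baseChangeFst k M := by
  obtain rfl : g ≫ f = k := congr_arg (fun l => l.as.unop) h'
  rw [selfIndexingCompHom_eq, baseChangeComp_hom_app_left_fst_fst]

lemma selfIndexingCompInv_fst {X Y Z : C} (f : Y ⟶ X) (g : Z ⟶ Y) (k : Z ⟶ X)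
    (h' : f.op.toLoc ≫ g.op.toLoc = k.op.toLoc) (M : Over X) :
    (selfIndexingCompInv f g k h' M).left ≫ baseChangeFst k M =
      baseChangeFst g ((baseChange f).obj M) ≫ baseChangeFst f M := by
  obtain rfl : g ≫ f = k := congr_arg (fun l => l.as.unop) h'
  rw [selfIndexingCompInv_eq]
  exact baseChangeComp_inv_app_left_fst g f M

lemma baseChange_left_hom_ext {X Y : C} {f : X ⟶ Y} {W : Over Y} {T : C}
    {a b : T ⟶ ((baseChange f).obj W).left}
    (h : a ≫ baseChangeFst f W = b ≫ baseChangeFst f W)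
    (h' : a ≫ ((baseChange f).obj W).hom = b ≫ ((baseChange f).obj W).hom) : a = b :=
  pullback.hom_ext h h'

/-- The comparison of the base changes along `k = g ≫ f` and `f`. -/
def baseChangeOf {X Y Z : C} (f : Y ⟶ X) (g : Z ⟶ Y) (k : Z ⟶ X) (h : g ≫ f = k) (M : Over X) :
    ((baseChange k).obj M).left ⟶ ((baseChange f).obj M).left :=
  pullback.lift (baseChangeFst k M) (((baseChange k).obj M).hom ≫ g)
    (by rw [Category.assoc, h]; exact baseChangeFst_w k M)

@[simp]
lemma baseChangeOf_fst {X Y Z : C} (f : Y ⟶ X) (g : Z ⟶ Y) (k : Z ⟶ X) (h : g ≫ f = k)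
    (M : Over X) : baseChangeOf f g k h M ≫ baseChangeFst f M = baseChangeFst k M :=
  pullback.lift_fst _ _ _

@[simp]
lemma baseChangeOf_hom {X Y Z : C} (f : Y ⟶ X) (g : Z ⟶ Y) (k : Z ⟶ X) (h : g ≫ f = k)
    (M : Over X) : baseChangeOf f g k h M ≫ ((baseChange f).obj M).hom =
      ((baseChange k).obj M).hom ≫ g :=
  pullback.lift_snd _ _ _

@[simp]
lemma baseChangeOf_hom_assoc {X Y Z : C} (f : Y ⟶ X) (g : Z ⟶ Y) (k : Z ⟶ X) (h : g ≫ f = k)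
    (M : Over X) {S : C} (t : Y ⟶ S) : baseChangeOf f g k h M ≫ ((baseChange f).obj M).hom ≫ t =
      ((baseChange k).obj M).hom ≫ g ≫ t := by
  rw [← Category.assoc, baseChangeOf_hom, Category.assoc]

lemma selfIndexingCompHom_left_fst {X Y Z : C} (f : Y ⟶ X) (g : Z ⟶ Y) (k : Z ⟶ X)
    (h : g ≫ f = k) (h' : f.op.toLoc ≫ g.op.toLoc = k.op.toLoc) (M : Over X) :
    (selfIndexingCompHom f g k h' M).left ≫ baseChangeFst g ((baseChange f).obj M) =
      baseChangeOf f g k h M := by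
  refine baseChange_left_hom_ext ?_ ?_
  · rw [Category.assoc, baseChangeOf_fst, selfIndexingCompHom_fst]
  · rw [Category.assoc, baseChangeOf_hom, baseChangeFst_w, Over.w_assoc]

/-- The pullback of a morphism between base changes, for the pseudofunctor `selfIndexing C`. -/
def overPullHom {X₁ X₂ Y Y' : C} {M₁ : Over X₁} {M₂ : Over X₂} {f₁ : Y ⟶ X₁}
    {f₂ : Y ⟶ X₂} (k : (baseChange f₁).obj M₁ ⟶ (baseChange f₂).obj M₂) (g : Y' ⟶ Y)
    (gf₁ : Y' ⟶ X₁) (gf₂ : Y' ⟶ X₂) (h₁ : g ≫ f₁ = gf₁) (h₂ : g ≫ f₂ = gf₂) :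
    (baseChange gf₁).obj M₁ ⟶ (baseChange gf₂).obj M₂ :=
  pullHom (F := selfIndexing C) (M₁ := M₁) (M₂ := M₂) k g gf₁ gf₂ h₁ h₂

/-- A morphism into a base change over the same base is determined by its first projection. This
formula is therefore all that is needed about `pullHom`, and the coherence isomorphisms disappear.
-/
lemma overPullHom_fst {X₁ X₂ Y Y' : C} {M₁ : Over X₁} {M₂ : Over X₂} {f₁ : Y ⟶ X₁}
    {f₂ : Y ⟶ X₂} (k : (baseChange f₁).obj M₁ ⟶ (baseChange f₂).obj M₂) (g : Y' ⟶ Y)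
    (gf₁ : Y' ⟶ X₁) (gf₂ : Y' ⟶ X₂) (h₁ : g ≫ f₁ = gf₁) (h₂ : g ≫ f₂ = gf₂) :
    (overPullHom k g gf₁ gf₂ h₁ h₂).left ≫ baseChangeFst gf₂ M₂ =
      baseChangeOf f₁ g gf₁ h₁ M₁ ≫ k.left ≫ baseChangeFst f₂ M₂ := by
  have e : overPullHom k g gf₁ gf₂ h₁ h₂ =
      selfIndexingCompHom f₁ g gf₁ (by subst h₁; rfl) M₁ ≫ (baseChange g).map k ≫
        selfIndexingCompInv f₂ g gf₂ (by subst h₂; rfl) M₂ := rfl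
  rw [e, Over.comp_left, Over.comp_left, Category.assoc, Category.assoc, selfIndexingCompInv_fst,
    baseChange_map_left_fst_assoc, ← Category.assoc, selfIndexingCompHom_left_fst (h := h₁)]

/-! ### Comparison of the two notions of descent datum -/

section DescentData

variable {ι : Type t} {X : C} {Z : ι → C} {f : ∀ i, Z i ⟶ X}

/-- The object over `Z i` of a descent datum. -/
def descentObj (D : (selfIndexing C).DescentData f) (i : ι) : Over (Z i) := D.obj i

/-- The gluing morphisms of a descent datum. -/
def descentHom (D : (selfIndexing C).DescentData f) {T : C} (q : T ⟶ X) {i j : ι} (a : T ⟶ Z i)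
    (b : T ⟶ Z j) (ha : a ≫ f i = q) (hb : b ≫ f j = q) :
    (baseChange a).obj (descentObj D i) ⟶ (baseChange b).obj (descentObj D j) :=
  D.hom q a b ha hb

lemma descentHom_self (D : (selfIndexing C).DescentData f) {T : C} (q : T ⟶ X) {i : ι}
    (a : T ⟶ Z i) (ha : a ≫ f i = q) : descentHom D q a a ha ha = 𝟙 _ :=
  D.hom_self q a ha

lemma descentHom_comp (D : (selfIndexing C).DescentData f) {T : C} (q : T ⟶ X) {i j k : ι}
    (a : T ⟶ Z i) (b : T ⟶ Z j) (c : T ⟶ Z k) (ha : a ≫ f i = q) (hb : b ≫ f j = q)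
    (hc : c ≫ f k = q) :
    descentHom D q a b ha hb ≫ descentHom D q b c hb hc = descentHom D q a c ha hc :=
  D.hom_comp q a b c ha hb hc

lemma descentHom_pull (D : (selfIndexing C).DescentData f) {T T' : C} (g : T' ⟶ T) (q : T ⟶ X)
    (q' : T' ⟶ X) (hq : g ≫ q = q') {i j : ι} (a : T ⟶ Z i) (b : T ⟶ Z j) (ha : a ≫ f i = q)
    (hb : b ≫ f j = q) (a' : T' ⟶ Z i) (b' : T' ⟶ Z j) (ha' : g ≫ a = a') (hb' : g ≫ b = b') :
    (descentHom D q' a' b' (by rw [← ha', Category.assoc, ha, hq])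
      (by rw [← hb', Category.assoc, hb, hq])).left ≫ baseChangeFst b' (descentObj D j) =
    baseChangeOf a g a' ha' (descentObj D i) ≫ (descentHom D q a b ha hb).left ≫
      baseChangeFst b (descentObj D j) := by
  rw [← overPullHom_fst (gf₂ := b') (h₂ := hb')]
  congr 2
  exact (D.pullHom_hom g q q' hq a b ha hb a' b' ha' hb').symm

/-- The section of a base change defined by a generalized element. -/
def baseChangeSection {T Z : C} {M : Over Z} (y : T ⟶ M.left) (a : T ⟶ Z) (h : y ≫ M.hom = a) :
    T ⟶ ((baseChange a).obj M).left :=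
  pullback.lift y (𝟙 T) (by rw [h, Category.id_comp])

@[simp]
lemma baseChangeSection_fst {T Z : C} {M : Over Z} (y : T ⟶ M.left) (a : T ⟶ Z)
    (h : y ≫ M.hom = a) : baseChangeSection y a h ≫ baseChangeFst a M = y :=
  pullback.lift_fst _ _ _

@[simp]
lemma baseChangeSection_hom {T Z : C} {M : Over Z} (y : T ⟶ M.left) (a : T ⟶ Z)
    (h : y ≫ M.hom = a) : baseChangeSection y a h ≫ ((baseChange a).obj M).hom = 𝟙 T :=
  pullback.lift_snd _ _ _

@[simp]
lemma baseChangeSection_fst_assoc {T Z : C} {M : Over Z} (y : T ⟶ M.left) (a : T ⟶ Z)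
    (h : y ≫ M.hom = a) {S : C} (t : M.left ⟶ S) :
    baseChangeSection y a h ≫ baseChangeFst a M ≫ t = y ≫ t := by
  rw [← Category.assoc, baseChangeSection_fst]

@[simp]
lemma baseChangeSection_hom_assoc {T Z : C} {M : Over Z} (y : T ⟶ M.left) (a : T ⟶ Z)
    (h : y ≫ M.hom = a) {S : C} (t : T ⟶ S) :
    baseChangeSection y a h ≫ ((baseChange a).obj M).hom ≫ t = t := by
  rw [← Category.assoc, baseChangeSection_hom]
  exact Category.id_comp t

/-- The transport of a generalized element `y` of a descent datum. -/
def descentTr (D : (selfIndexing C).DescentData f) {T : C} (q : T ⟶ X) {i j : ι}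
    (y : T ⟶ (descentObj D i).left) (a : T ⟶ Z i) (b : T ⟶ Z j)
    (hy : y ≫ (descentObj D i).hom = a) (ha : a ≫ f i = q) (hb : b ≫ f j = q) :
    T ⟶ (descentObj D j).left :=
  baseChangeSection y a hy ≫ (descentHom D q a b ha hb).left ≫ baseChangeFst b _

lemma descentTr_hom (D : (selfIndexing C).DescentData f) {T : C} (q : T ⟶ X) {i j : ι}
    (y : T ⟶ (descentObj D i).left) (a : T ⟶ Z i) (b : T ⟶ Z j)
    (hy : y ≫ (descentObj D i).hom = a) (ha : a ≫ f i = q) (hb : b ≫ f j = q) :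
    descentTr D q y a b hy ha hb ≫ (descentObj D j).hom = b := by
  rw [descentTr, Category.assoc, Category.assoc, baseChangeFst_w, Over.w_assoc,
    baseChangeSection_hom_assoc]

lemma baseChangeSection_descentTr (D : (selfIndexing C).DescentData f) {T : C} (q : T ⟶ X)
    {i j : ι} (y : T ⟶ (descentObj D i).left) (a : T ⟶ Z i) (b : T ⟶ Z j)
    (hy : y ≫ (descentObj D i).hom = a) (ha : a ≫ f i = q) (hb : b ≫ f j = q) :
    baseChangeSection (descentTr D q y a b hy ha hb) b (descentTr_hom D q y a b hy ha hb) =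
      baseChangeSection y a hy ≫ (descentHom D q a b ha hb).left := by
  refine baseChange_left_hom_ext ?_ ?_
  · rw [baseChangeSection_fst, descentTr, Category.assoc]
  · rw [baseChangeSection_hom, Category.assoc, Over.w, baseChangeSection_hom]

lemma comp_descentTr (D : (selfIndexing C).DescentData f) {T T' : C} (g : T' ⟶ T) (q : T ⟶ X)
    {i j : ι} (y : T ⟶ (descentObj D i).left) (a : T ⟶ Z i) (b : T ⟶ Z j)
    (hy : y ≫ (descentObj D i).hom = a) (ha : a ≫ f i = q) (hb : b ≫ f j = q)
    (q' : T' ⟶ X) (hq : g ≫ q = q') (a' : T' ⟶ Z i) (ha' : g ≫ a = a') :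
    g ≫ descentTr D q y a b hy ha hb = descentTr D q' (g ≫ y) a' (g ≫ b)
      (by rw [Category.assoc, hy, ha']) (by rw [← ha', Category.assoc, ha, hq])
      (by rw [Category.assoc, hb, hq]) := by
  have e : g ≫ baseChangeSection y a hy =
      baseChangeSection (g ≫ y) a' (by rw [Category.assoc, hy, ha']) ≫
        baseChangeOf a g a' ha' (descentObj D i) := by
    refine baseChange_left_hom_ext ?_ ?_ <;> simp
  rw [descentTr, descentTr, descentHom_pull D g q q' hq a b ha hb a' _ ha' rfl,
    ← Category.assoc, e, Category.assoc]

lemma descentTr_self (D : (selfIndexing C).DescentData f) {T : C} (q : T ⟶ X) {i : ι}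
    (y : T ⟶ (descentObj D i).left) (a : T ⟶ Z i) (hy : y ≫ (descentObj D i).hom = a)
    (ha : a ≫ f i = q) : descentTr D q y a a hy ha ha = y := by
  simp [descentTr, descentHom_self]

lemma descentTr_descentTr (D : (selfIndexing C).DescentData f) {T : C} (q : T ⟶ X) {i j k : ι}
    (y : T ⟶ (descentObj D i).left) (a : T ⟶ Z i) (b : T ⟶ Z j) (c : T ⟶ Z k)
    (hy : y ≫ (descentObj D i).hom = a) (ha : a ≫ f i = q) (hb : b ≫ f j = q) (hc : c ≫ f k = q) :
    descentTr D q (descentTr D q y a b hy ha hb) b c (descentTr_hom D q y a b hy ha hb) hb hc =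
      descentTr D q y a c hy ha hc := by
  rw [descentTr, baseChangeSection_descentTr, descentTr, ← descentHom_comp D q a b c ha hb hc,
    Over.comp_left]
  simp only [Category.assoc]

lemma descentTr_congr (D : (selfIndexing C).DescentData f) {T : C} {q q' : T ⟶ X} {i j : ι}
    {y y' : T ⟶ (descentObj D i).left} {a a' : T ⟶ Z i} (hy' : y = y') (b : T ⟶ Z j)
    (hq : q = q') (ha' : a = a') (hy : y ≫ (descentObj D i).hom = a) (ha : a ≫ f i = q)
    (hb : b ≫ f j = q) : descentTr D q y a b hy ha hb = descentTr D q' y' a' b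
      (by rw [← hy', hy, ha']) (by rw [← ha', ha, hq]) (hb.trans hq) := by
  subst hq ha' hy'
  rfl

/-- The description of a descent datum in terms of generalized elements. -/
def OverDescent.ofDescentData (D : (selfIndexing C).DescentData f) : OverDescent f where
  Y i := (descentObj D i).left
  p i := (descentObj D i).hom
  tr {T i j} y z h := descentTr D (z ≫ f j) y (y ≫ (descentObj D i).hom) z rfl
    (by rw [Category.assoc, h]) rfl
  tr_p {T i j} y z h := descentTr_hom D _ _ _ _ _ _ _
  comp_tr {T T' i j} g y z h :=
    comp_descentTr D g _ _ _ _ _ _ _ _ (Category.assoc _ _ _).symm _ (Category.assoc _ _ _).symm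
  tr_self {T i} y := descentTr_self D _ _ _ _ _
  tr_tr {T i j k} y z z' h h' :=
    (descentTr_congr D (descentTr_congr D rfl z h' rfl _ _ _) z' rfl
      (descentTr_hom D _ _ _ _ _ _ _) _ _ _).trans
        (descentTr_descentTr D _ _ _ _ _ _ (by rw [Category.assoc, h, h']) h' _)

/-- The gluing morphism is the transport of the universal element of the base change along `a`, so
transports recover the whole datum. -/
lemma descentHom_left_fst (D : (selfIndexing C).DescentData f) {T : C} (q : T ⟶ X) {i j : ι}
    (a : T ⟶ Z i) (b : T ⟶ Z j) (ha : a ≫ f i = q) (hb : b ≫ f j = q) :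
    (descentHom D q a b ha hb).left ≫ baseChangeFst b _ =
      descentTr D (((baseChange a).obj (descentObj D i)).hom ≫ q) (baseChangeFst a _)
        (((baseChange a).obj (descentObj D i)).hom ≫ a)
        (((baseChange a).obj (descentObj D i)).hom ≫ b) (baseChangeFst_w a _)
        (by rw [Category.assoc, ha]) (by rw [Category.assoc, hb]) := by
  have e : baseChangeSection (baseChangeFst a _)
      (((baseChange a).obj (descentObj D i)).hom ≫ a) (baseChangeFst_w a _) ≫
        baseChangeOf a ((baseChange a).obj (descentObj D i)).hom _ rfl (descentObj D i) =
        𝟙 _ := by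
    refine baseChange_left_hom_ext ?_ ?_ <;> simp
  rw [descentTr, descentHom_pull D _ q _ rfl a b ha hb _ _ rfl rfl, reassoc_of% e]

/-- The gluing morphisms of the descent datum for the pseudofunctor `selfIndexing C` attached to a
descent datum in terms of generalized elements. -/
def OverDescent.baseHom (D : OverDescent f) {T : C} (q : T ⟶ X) {i j : ι} (a : T ⟶ Z i)
    (b : T ⟶ Z j) (ha : a ≫ f i = q) (hb : b ≫ f j = q) :
    (baseChange a).obj (Over.mk (D.p i)) ⟶ (baseChange b).obj (Over.mk (D.p j)) :=
  baseChangeLift (D.tr (baseChangeFst a (Over.mk (D.p i)))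
    (((baseChange a).obj (Over.mk (D.p i))).hom ≫ b) (by
      have := baseChangeFst_w a (Over.mk (D.p i)) =≫ f i
      simp only [Category.assoc] at this
      rw [Category.assoc, hb, ← ha]
      exact this)) (D.tr_p _ _ _)

lemma OverDescent.comp_baseHom_left_fst (D : OverDescent f) {T : C} (q : T ⟶ X) {i j : ι}
    (a : T ⟶ Z i) (b : T ⟶ Z j) (ha : a ≫ f i = q) (hb : b ≫ f j = q) {T' : C}
    (s : T' ⟶ ((baseChange a).obj (Over.mk (D.p i))).left) (y : T' ⟶ D.Y i) (z : T' ⟶ Z j)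
    (hy : s ≫ baseChangeFst a (Over.mk (D.p i)) = y)
    (hz : s ≫ ((baseChange a).obj (Over.mk (D.p i))).hom ≫ b = z)
    (h : y ≫ D.p i ≫ f i = z ≫ f j) :
    s ≫ (D.baseHom q a b ha hb).left ≫ baseChangeFst b (Over.mk (D.p j)) = D.tr y z h := by
  rw [OverDescent.baseHom, baseChangeLift_left_fst, D.comp_tr]
  exact D.tr_congr hy hz _

/-- The descent datum for the pseudofunctor `selfIndexing C` attached to a descent datum in terms of
generalized elements. -/
def OverDescent.toDescentData (D : OverDescent f) : (selfIndexing C).DescentData f where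
  obj i := Over.mk (D.p i)
  hom T q i j a b ha hb := D.baseHom q a b ha hb
  pullHom_hom T' T g q q' hq i j a b ha hb a' b' ha' hb' := by
    have hq' : b' ≫ f j = q' := by rw [← hb', Category.assoc, hb, hq]
    have hq'' : a' ≫ f i = q' := by rw [← ha', Category.assoc, ha, hq]
    have e : overPullHom (D.baseHom q a b ha hb) g a' b' ha' hb' =
        D.baseHom q' a' b' hq'' hq' := by
      refine baseChange_hom_ext ((overPullHom_fst _ g a' b' ha' hb').trans ?_)
      rw [D.comp_baseHom_left_fst q a b ha hb _ (baseChangeFst a' (Over.mk (D.p i)))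
        (((baseChange a').obj (Over.mk (D.p i))).hom ≫ b') (baseChangeOf_fst _ _ _ _ _),
        OverDescent.baseHom, baseChangeLift_left_fst]
      · rw [baseChangeOf_hom_assoc, hb']
    exact e
  hom_self T q i g h := by
    have e : D.baseHom q g g h h = 𝟙 _ := by
      refine baseChange_hom_ext ((baseChangeLift_left_fst _ _).trans ?_)
      refine (D.tr_congr rfl (baseChangeFst_w g (Over.mk (D.p i))).symm _).trans ?_
      exact (D.tr_self _).trans (Category.id_comp _).symm
    exact e
  hom_comp T q i j k a b c ha hb hc := by
    have e : D.baseHom q a b ha hb ≫ D.baseHom q b c hb hc = D.baseHom q a c ha hc := by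
      refine baseChange_hom_ext (((Category.assoc _ _ _).trans
        (D.comp_baseHom_left_fst q b c hb hc _ _ (((baseChange a).obj (Over.mk (D.p i))).hom ≫ c)
          (baseChangeLift_left_fst _ _) (Over.w_assoc _ _) ?_)).trans ?_)
      · rw [← Category.assoc, D.tr_p, Category.assoc, Category.assoc, hb, hc]
      · rw [OverDescent.baseHom, baseChangeLift_left_fst]
        refine D.tr_tr _ _ _ _ ?_
        rw [Category.assoc, Category.assoc, hb, hc]
    exact e

/-- The gluing morphisms of the descent datum attached to an object of `Over X`. -/
def ofObjHom (f : ∀ i, Z i ⟶ X) (W : Over X) {T : C} (q : T ⟶ X) {i j : ι}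
    (a : T ⟶ Z i) (b : T ⟶ Z j) (ha : a ≫ f i = q) (hb : b ≫ f j = q) :
    (baseChange a).obj ((baseChange (f i)).obj W) ⟶ (baseChange b).obj ((baseChange (f j)).obj W) :=
  selfIndexingCompInv (f i) a q (by rw [← ha]; rfl) W ≫
    selfIndexingCompHom (f j) b q (by rw [← hb]; rfl) W

lemma ofObjHom_fst (f : ∀ i, Z i ⟶ X) (W : Over X) {T : C} (q : T ⟶ X) {i j : ι}
    (a : T ⟶ Z i) (b : T ⟶ Z j) (ha : a ≫ f i = q) (hb : b ≫ f j = q) :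
    (ofObjHom f W q a b ha hb).left ≫
      baseChangeFst b ((baseChange (f j)).obj W) ≫ baseChangeFst (f j) W =
      baseChangeFst a ((baseChange (f i)).obj W) ≫ baseChangeFst (f i) W := by
  rw [ofObjHom, Over.comp_left, Category.assoc, selfIndexingCompHom_fst, selfIndexingCompInv_fst]

lemma isPullback_of_iso_baseChange {Y : C} {g : Y ⟶ X} {W : Over X} {V : Over Y}
    (k : V ≅ (baseChange g).obj W) : IsPullback (k.hom.left ≫ baseChangeFst g W) V.hom W.hom g := by
  have h : IsPullback (baseChangeFst g W) ((baseChange g).obj W).hom W.hom g :=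
    IsPullback.of_hasPullback W.hom g
  refine h.of_iso ((Over.forget _).mapIso k).symm (Iso.refl _) (Iso.refl _) (Iso.refl _) ?_ ?_
    (by simp) (by simp)
  · change _ ≫ 𝟙 _ = k.inv.left ≫ k.hom.left ≫ _
    rw [← Category.assoc k.inv.left, ← Over.comp_left, k.inv_hom_id]
    simp
  · exact (Category.comp_id _).trans (Over.w k.inv).symm

lemma OverDescent.isEffective_of_essSurj (D : OverDescent f)
    (h : ((selfIndexing C).toDescentData f).EssSurj) : D.IsEffective := by
  obtain ⟨W, ⟨φ⟩⟩ := h.mem_essImage D.toDescentData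
  replace φ := φ.symm
  let W' : Over X := W
  let k (i : ι) : Over.mk (D.p i) ≅ (baseChange (f i)).obj W' :=
    { hom := φ.hom.hom i
      inv := φ.inv.hom i
      hom_inv_id := congr_arg (fun α => α.hom i) φ.hom_inv_id
      inv_hom_id := congr_arg (fun α => α.hom i) φ.inv_hom_id }
  refine ⟨W'.left, W'.hom, fun i => (k i).hom.left ≫ baseChangeFst (f i) W',
    fun i => isPullback_of_iso_baseChange (k i), ?_⟩
  intro T i j y z h
  have hc : (baseChange (y ≫ D.p i)).map (k i).hom ≫
      ofObjHom f W' (z ≫ f j) (y ≫ D.p i) z (by rw [Category.assoc, h]) rfl =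
      D.baseHom (z ≫ f j) (y ≫ D.p i) z (by rw [Category.assoc, h]) rfl ≫
        (baseChange z).map (k j).hom :=
    φ.hom.comm (z ≫ f j) (y ≫ D.p i) z (by rw [Category.assoc, h]) rfl
  -- Evaluating the compatibility square at the section defined by `y` turns it into a statement
  -- about the transport of `y`.
  have hs := congr_arg (fun α => baseChangeSection (M := Over.mk (D.p i)) y (y ≫ D.p i) rfl ≫
    α.left ≫ baseChangeFst z _ ≫ baseChangeFst (f j) W') hc
  dsimp only [Over.comp_left] at hs
  simp only [Category.assoc, ofObjHom_fst, baseChange_map_left_fst_assoc,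
    baseChangeSection_fst_assoc] at hs
  rw [hs, ← D.comp_baseHom_left_fst (z ≫ f j) (y ≫ D.p i) z (by rw [Category.assoc, h]) rfl
    (baseChangeSection (M := Over.mk (D.p i)) y (y ≫ D.p i) rfl) y z (by simp) (by simp) h]
  simp only [Category.assoc]

lemma exists_iso_of_isEffective (D : (selfIndexing C).DescentData f)
    (h : (OverDescent.ofDescentData D).IsEffective) :
    ((selfIndexing C).toDescentData f).essImage D := by
  obtain ⟨W, q, (e : ∀ i, (descentObj D i).left ⟶ W),
    (he : ∀ i, IsPullback (e i) (descentObj D i).hom q (f i)), htr⟩ := h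
  replace htr : ∀ {T : C} {i j : ι} (y : T ⟶ (descentObj D i).left) (z : T ⟶ Z j)
    (h : y ≫ (descentObj D i).hom ≫ f i = z ≫ f j),
    descentTr D (z ≫ f j) y (y ≫ (descentObj D i).hom) z rfl (by rw [Category.assoc, h]) rfl ≫
      e j = y ≫ e i := htr
  have hp (i : ι) : IsPullback (baseChangeFst (f i) (Over.mk q))
      ((baseChange (f i)).obj (Over.mk q)).hom q (f i) := IsPullback.of_hasPullback q (f i)
  let k (i : ι) : descentObj D i ≅ (baseChange (f i)).obj (Over.mk q) :=
    Over.isoMk ((he i).isoIsPullback _ _ (hp i)) (by simp)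
  have hk (i : ι) : (k i).hom.left ≫ baseChangeFst (f i) (Over.mk q) = e i := by simp [k]
  refine ⟨Over.mk q, ⟨Iso.symm (Pseudofunctor.DescentData.isoMk k ?_)⟩⟩
  intro T t i j a b ha hb
  have hc : (baseChange a).map (k i).hom ≫ ofObjHom f (Over.mk q) t a b ha hb =
      descentHom D t a b ha hb ≫ (baseChange b).map (k j).hom := by
    refine baseChange_hom_ext (baseChange_left_hom_ext ?_ ?_)
    · simp only [Over.comp_left, Category.assoc, ofObjHom_fst, baseChange_map_left_fst_assoc, hk,
        baseChange_map_left_fst]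
      have := htr (baseChangeFst a (descentObj D i))
        (((baseChange a).obj (descentObj D i)).hom ≫ b) (by
          rw [baseChangeFst_w_assoc, Category.assoc, ha, hb])
      rw [← this]
      refine Eq.trans ?_ (Category.assoc (descentHom D t a b ha hb).left (baseChangeFst b _) (e j))
      rw [descentHom_left_fst]
      congr 1
      refine descentTr_congr D rfl _ ?_ ?_ _ _ _
      · rw [Category.assoc, hb]
      · exact baseChangeFst_w a (descentObj D i)
    · rw [Category.assoc, Category.assoc, baseChangeFst_w, Over.w_assoc, Over.w_assoc]
  exact hc

variable {J : GrothendieckTopology C} [J.Subcanonical]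

/-- The pullback of the cover to the total space of `M` is again a cover, and covers are jointly
epimorphic. -/
lemma faithful_toDescentData (hf : Sieve.ofArrows Z f ∈ J X) :
    ((selfIndexing C).toDescentData f).Faithful where
  map_injective {M N} a b hab := by
    let M' : Over X := M
    let N' : Over X := N
    let a' : M' ⟶ N' := a
    let b' : M' ⟶ N' := b
    have h (i : ι) : (baseChange (f i)).map a' = (baseChange (f i)).map b' :=
      congr_arg (fun α => α.hom i) hab
    have : a' = b' := by
      ext
      refine hom_ext_of_cover (fun i => baseChangeFst (f i) M')
        (baseChange_mem_topology M'.hom hf (fun i => IsPullback.of_hasPullback M'.hom (f i)))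
        fun i => ?_
      rw [← baseChange_map_left_fst, h, baseChange_map_left_fst]
    exact this

/-- The local morphisms, composed with the projections to `N`, glue along the cover pulled back to
the total space of `M`. -/
lemma full_toDescentData (hf : Sieve.ofArrows Z f ∈ J X) :
    ((selfIndexing C).toDescentData f).Full where
  map_surjective {M N} φ := by
    let M' : Over X := M
    let N' : Over X := N
    let k (i : ι) : (baseChange (f i)).obj M' ⟶ (baseChange (f i)).obj N' := φ.hom i
    have hk {T : C} (q : T ⟶ X) {i j : ι} (a : T ⟶ Z i) (b : T ⟶ Z j) (ha : a ≫ f i = q)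
        (hb : b ≫ f j = q) : (baseChange a).map (k i) ≫ ofObjHom f N' q a b ha hb =
        ofObjHom f M' q a b ha hb ≫ (baseChange b).map (k j) := φ.comm q a b ha hb
    have hM := baseChange_mem_topology M'.hom hf
      (fun i => IsPullback.of_hasPullback M'.hom (f i))
    obtain ⟨g, hg⟩ := exists_glue (fun i => baseChangeFst (f i) M') hM
      (fun i => (k i).left ≫ baseChangeFst (f i) N') (by
        intro T i j a b hab
        have hq : (b ≫ ((baseChange (f j)).obj M').hom) ≫ f j =
            (a ≫ ((baseChange (f i)).obj M').hom) ≫ f i := by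
          rw [Category.assoc, Category.assoc, ← baseChangeFst_w, ← baseChangeFst_w,
            reassoc_of% hab]
        -- Compatibility of `φ` is evaluated at the section given by `a`; by `e` below, the gluing
        -- morphism of `M'` carries it to the section given by `b`.
        have h := congr_arg (fun α => baseChangeSection a _ rfl ≫ α.left ≫ baseChangeFst _ _ ≫
          baseChangeFst (f j) N') (hk _ (a ≫ ((baseChange (f i)).obj M').hom)
            (b ≫ ((baseChange (f j)).obj M').hom) rfl hq)
        have e : baseChangeSection a _ rfl ≫ (ofObjHom f M' _
            (a ≫ ((baseChange (f i)).obj M').hom) (b ≫ ((baseChange (f j)).obj M').hom)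
              rfl hq).left = baseChangeSection b _ rfl := by
          refine baseChange_left_hom_ext (baseChange_left_hom_ext ?_ ?_) ?_
          · simp only [Category.assoc, ofObjHom_fst, baseChangeSection_fst_assoc, hab]
          · simp only [Category.assoc, baseChangeFst_w, Over.w_assoc, baseChangeSection_hom_assoc]
          · simp only [Category.assoc, Over.w, baseChangeSection_hom]
        dsimp only [Over.comp_left] at h
        simp only [Category.assoc, ofObjHom_fst, baseChange_map_left_fst_assoc,
          baseChangeSection_fst_assoc] at h
        rw [reassoc_of% e] at h
        simpa using h)
    let g' : M' ⟶ N' := Over.homMk g (hom_ext_of_cover (fun i => baseChangeFst (f i) M') hM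
      fun i => by
      rw [reassoc_of% hg i, baseChangeFst_w, Over.w_assoc, baseChangeFst_w])
    refine ⟨g', ?_⟩
    ext i
    have : (baseChange (f i)).map g' = k i := by
      refine baseChange_hom_ext ?_
      rw [baseChange_map_left_fst, ← hg i]
      rfl
    exact this

end DescentData

/-- For a subcanonical topology, the self-indexing is a stack as soon as descent data in terms of
generalized elements are effective. -/
lemma isStack_selfIndexing {J : GrothendieckTopology C} [J.Subcanonical]
    (h : ∀ (X : C) (S : Sieve X) (_ : S ∈ J X)
      (D : OverDescent (fun g : S.arrows.category => g.obj.hom)), D.IsEffective) :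
    (selfIndexing C).IsStack J :=
  .of_isStackFor fun X S hS => by
    have hS' : Sieve.ofArrows _ (fun g : S.arrows.category => g.obj.hom) ∈ J X := by
      rwa [Sieve.ofArrows_category', Sieve.generate_sieve]
    rw [isStackFor_iff]
    have := faithful_toDescentData hS'
    have := full_toDescentData hS'
    have : ((selfIndexing C).toDescentData fun g : S.arrows.category => g.obj.hom).EssSurj :=
      ⟨fun D => exists_iso_of_isEffective D (h X S hS _)⟩
    exact { }

/-- Stated for families generating a covering sieve: the underlying morphisms of a sieve of
coalgebras form such a family, not a sieve. -/
lemma OverDescent.isEffective_of_isStack {J : GrothendieckTopology C}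
    [(selfIndexing C).IsStack J] {ι : Type t} {X : C} {Z : ι → C} {f : ∀ i, Z i ⟶ X}
    (hf : Sieve.ofArrows Z f ∈ J X) (D : OverDescent f) : D.IsEffective :=
  have := (selfIndexing C).isEquivalence_toDescentData f hf
  D.isEffective_of_essSurj inferInstance

end Descent
-- Dense subcategories: gluing from points, exponentials, classifiers
section Density

variable {E : Type u₁} [Category.{v₁} E] {F : Type u₂} [Category.{v₂} F] (i : E ⥤ F)

lemma coconeAt_ι_app (X : F) (g : CostructuredArrow i X) :
    ((Functor.LeftExtension.mk (𝟭 F) i.rightUnitor.inv).coconeAt X).ι.app g = g.hom :=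
  Category.id_comp _

/-- A covering sieve contains all points of `X`, so a compatible family restricts to a cocone on the
canonical diagram, and density gives the amalgamation. Agreement on the other members of the sieve
is tested on their points. -/
lemma subcanonical_inducedTopology [i.IsDense] : (inducedTopology i).Subcanonical := by
  refine .of_isSheaf_yoneda_obj _ fun T X S hS x hx => ?_
  let c : Cocone (CostructuredArrow.proj i X ⋙ i) :=
    { pt := T
      ι :=
        { app g := x g.hom (hS _ _)
          naturality g g' a := by
            have := hx (i.map a.left) (𝟙 _) (hS _ g'.hom) (hS _ g.hom) (by simp)
            exact this.trans ((Category.id_comp _).trans (Category.comp_id _).symm) } }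
  have hc (A : E) (g : i.obj A ⟶ X) : g ≫ (i.denseAt X).desc c = x g (hS _ _) := by
    have := (i.denseAt X).fac c (CostructuredArrow.mk g)
    rw [coconeAt_ι_app] at this
    exact this
  have hext {W : F} {a b : W ⟶ T} (h : ∀ (A : E) (g : i.obj A ⟶ W), g ≫ a = g ≫ b) : a = b :=
    (i.denseAt W).hom_ext fun g => by
      rw [coconeAt_ι_app]
      exact h _ _
  refine ⟨(i.denseAt X).desc c, fun W g hg => hext fun A a => ?_, fun t ht => hext fun A g => ?_⟩
  · have := hx a (𝟙 _) hg (hS _ (a ≫ g)) (by simp)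
    refine Eq.trans ?_ (((hc A (a ≫ g)).trans (Category.id_comp _).symm).trans this.symm)
    exact (Category.assoc _ _ _).symm
  · rw [hc]
    exact ht _ _

/-- Two morphisms which agree on all `i.obj A ⟶ X` are equal. -/
lemma hom_ext_of_points [(inducedTopology i).Subcanonical] {X T : F} {t t' : X ⟶ T}
    (h : ∀ (A : E) (g : i.obj A ⟶ X), g ≫ t = g ≫ t') : t = t' :=
  hom_ext_of_cover (J := inducedTopology i) (fun g : Σ A, (i.obj A ⟶ X) => g.2)
    (fun A g => ⟨_, 𝟙 _, _, .mk (⟨A, g⟩ : Σ A, (i.obj A ⟶ X)), Category.id_comp _⟩)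
    fun g => h g.1 g.2

/-- A morphism `X ⟶ T` can be defined by its composites with all `i.obj A ⟶ X`. -/
lemma exists_hom_of_points [i.Full] [(inducedTopology i).Subcanonical] {X T : F}
    (k : ∀ A : E, (i.obj A ⟶ X) → (i.obj A ⟶ T))
    (hk : ∀ {A B : E} (a : A ⟶ B) (g : i.obj B ⟶ X), k A (i.map a ≫ g) = i.map a ≫ k B g) :
    ∃ t : X ⟶ T, ∀ (A : E) (g : i.obj A ⟶ X), g ≫ t = k A g := by
  obtain ⟨t, ht⟩ := exists_glue (J := inducedTopology i) (fun g : Σ A, (i.obj A ⟶ X) => g.2)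
    (fun A g => ⟨_, 𝟙 _, _, .mk (⟨A, g⟩ : Σ A, (i.obj A ⟶ X)), Category.id_comp _⟩)
    (fun g => k g.1 g.2) (by
      intro W g g' a b h
      -- `W` need not come from `E`; on its points both legs lift to `E` by fullness, and the
      -- naturality `hk` applies.
      refine hom_ext_of_points i fun D d => ?_
      obtain ⟨a', ha'⟩ := i.map_surjective (d ≫ a)
      obtain ⟨b', hb'⟩ := i.map_surjective (d ≫ b)
      rw [← Category.assoc, ← Category.assoc, ← ha', ← hb', ← hk, ← hk, ha', hb',
        Category.assoc, h, Category.assoc])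
  exact ⟨t, fun A g => ht ⟨A, g⟩⟩

/-- The cocones on the canonical diagram of `X` are exactly the natural families of values on
points. -/
lemma isDense_of_points (hext : ∀ {X T : F} {t t' : X ⟶ T},
      (∀ (A : E) (g : i.obj A ⟶ X), g ≫ t = g ≫ t') → t = t')
    (h : ∀ {X T : F} (k : ∀ A : E, (i.obj A ⟶ X) → (i.obj A ⟶ T)),
      (∀ {A B : E} (a : A ⟶ B) (g : i.obj B ⟶ X), k A (i.map a ≫ g) = i.map a ≫ k B g) →
      ∃ t : X ⟶ T, ∀ (A : E) (g : i.obj A ⟶ X), g ≫ t = k A g) : i.IsDense where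
  isDenseAt X := by
    have hs (s : Cocone (CostructuredArrow.proj i X ⋙ i)) : ∃ t : X ⟶ s.pt,
        ∀ (A : E) (g : i.obj A ⟶ X), g ≫ t = s.ι.app (CostructuredArrow.mk g) :=
      h (fun A g => s.ι.app (CostructuredArrow.mk g)) fun {A B} a g =>
        (s.w (CostructuredArrow.homMk a : CostructuredArrow.mk (i.map a ≫ g) ⟶
          CostructuredArrow.mk g)).symm
    choose d hd using hs
    refine ⟨{ desc := d, fac := fun s g => ?_, uniq := fun s m hm => hext fun A g => ?_ }⟩
    · rw [coconeAt_ι_app]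
      exact hd s _ g.hom
    · refine Eq.trans ?_ ((hm (CostructuredArrow.mk g)).trans (hd s A g).symm)
      rw [coconeAt_ι_app]
      rfl

variable {i}

/-- Fullness gives the universal property against objects `i.obj D`. For general `Z`, transpose over
each point of `Z`; uniqueness makes the transposes natural, so they glue. -/
lemma isExponential_map [HasFiniteLimits E] [HasFiniteLimits F] [i.Full] [i.Faithful]
    [PreservesFiniteLimits i] [(inducedTopology i).Subcanonical] {A X B : E} {ev : A ⨯ X ⟶ B}
    (hev : IsExponential ev) {ev' : i.obj A ⨯ i.obj X ⟶ i.obj B}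
    (h : prodComparison i A X ≫ ev' = i.map ev) : IsExponential ev' := by
  have key (D : E) (f : i.obj A ⨯ i.obj D ⟶ i.obj B) :
      ∃! g : i.obj D ⟶ i.obj X, prod.map (𝟙 _) g ≫ ev' = f := by
    obtain ⟨f', hf'⟩ := i.map_surjective (prodComparison i A D ≫ f)
    have e (g : D ⟶ X) : prod.map (𝟙 _) (i.map g) ≫ ev' = f ↔ prod.map (𝟙 _) g ≫ ev = f' := by
      rw [← i.map_injective.eq_iff, hf', i.map_comp, ← h, prodComparison_natural_assoc,
        cancel_epi, i.map_id]
    obtain ⟨g, hg, hg'⟩ := hev D f'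
    refine ⟨i.map g, (e g).2 hg, fun k hk => ?_⟩
    obtain ⟨k, rfl⟩ := i.map_surjective k
    rw [hg' k ((e k).1 hk)]
  intro Z f
  choose k hk hk' using fun (D : E) (g : i.obj D ⟶ Z) => key D (prod.map (𝟙 _) g ≫ f)
  obtain ⟨t, ht⟩ := exists_hom_of_points i k fun {C D} a g => by
    refine (hk' _ _ _ ?_).symm
    have e : prod.map (𝟙 (i.obj A)) (i.map a ≫ k D g) =
        prod.map (𝟙 _) (i.map a) ≫ prod.map (𝟙 _) (k D g) := by simp
    have e' : prod.map (𝟙 (i.obj A)) (i.map a ≫ g) =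
        prod.map (𝟙 _) (i.map a) ≫ prod.map (𝟙 _) g := by simp
    dsimp only
    rw [e, e', Category.assoc, hk, Category.assoc]
  refine ⟨t, hom_ext_of_points i fun D d => ?_, fun t' ht' => hom_ext_of_points i fun D d => ?_⟩
  · have e : prod.lift (d ≫ prod.fst) (𝟙 _) ≫ prod.map (𝟙 _) (d ≫ prod.snd) = d := by
      rw [prod.lift_map, Category.comp_id, Category.id_comp]
      exact prod.hom_ext (prod.lift_fst _ _) (prod.lift_snd _ _)
    have e' : prod.map (𝟙 (i.obj A)) (d ≫ prod.snd) ≫ prod.map (𝟙 _) t =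
        prod.map (𝟙 _) (k D (d ≫ prod.snd)) := by
      simp [← ht]
    rw [← e, Category.assoc, Category.assoc, reassoc_of% e', hk]
  · rw [ht]
    refine hk' _ _ _ ?_
    have e : prod.map (𝟙 (i.obj A)) (d ≫ t') = prod.map (𝟙 _) d ≫ prod.map (𝟙 _) t' := by simp
    dsimp only
    rw [e, Category.assoc, ht']

/-- The subobjects of the objects `i.obj A` are in the essential image of `i`. -/
def SubobjectClosed (i : E ⥤ F) : Prop :=
  ∀ {A : E} {U : F} (m : U ⟶ i.obj A) [Mono m], ∃ (B : E), Nonempty (U ≅ i.obj B)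

/-- Both the subobject and every candidate characteristic map come from `E`, where `c` classifies.
-/
lemma existsUnique_char [HasFiniteLimits E] [i.Full] [i.Faithful] [PreservesFiniteLimits i]
    (hsub : SubobjectClosed i) (c : Subobject.Classifier E) {A : E} {U : F} (m : U ⟶ i.obj A)
    [Mono m] : ∃! χ : i.obj A ⟶ i.obj c.Ω,
      ∃ u : U ⟶ i.obj c.Ω₀, IsPullback m u χ (i.map c.truth) := by
  obtain ⟨B, ⟨e⟩⟩ := hsub m
  obtain ⟨n, hn⟩ := i.map_surjective (e.inv ≫ m)
  have : Mono (i.map n) := by rw [hn]; infer_instance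
  have : Mono n := i.mono_of_mono_map this
  have hm : e.hom ≫ i.map n = m := by rw [hn, e.hom_inv_id_assoc]
  refine ⟨i.map (c.χ n), ⟨e.hom ≫ i.map (c.χ₀ B), ?_⟩, ?_⟩
  · exact ((c.isPullback n).map i).of_iso e.symm (Iso.refl _) (Iso.refl _) (Iso.refl _)
      (by simp [hn]) (by simp) (by simp) (by simp)
  · rintro χ ⟨u, hu⟩
    obtain ⟨χ, rfl⟩ := i.map_surjective χ
    obtain ⟨u', hu'⟩ := i.map_surjective (e.inv ≫ u)
    congr 1
    refine c.uniq n (χ₀' := u') (IsPullback.of_map i ?_ ?_)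
    · apply i.map_injective
      rw [i.map_comp, i.map_comp, hn, hu', Category.assoc, Category.assoc, hu.w]
    · rw [hu', hn]
      exact hu.of_iso e (Iso.refl _) (Iso.refl _) (Iso.refl _) (by simp) (by simp) (by simp)
        (by simp)

/-- Membership form of classification: an element of `X` lies in `U` exactly when `χ` sends it to
true. -/
lemma isPullback_from_iff {U X Ω₀ Ω : F} (ht : IsTerminal Ω₀) (m : U ⟶ X) [Mono m] (χ : X ⟶ Ω)
    (τ : Ω₀ ⟶ Ω) : IsPullback m (ht.from U) χ τ ↔
      ∀ {T : F} (x : T ⟶ X), (∃ y : T ⟶ U, y ≫ m = x) ↔ x ≫ χ = ht.from T ≫ τ := by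
  refine ⟨fun h T x => ⟨?_, fun hx => ⟨h.lift x (ht.from T) hx, h.lift_fst _ _ _⟩⟩, fun h => ?_⟩
  · rintro ⟨y, rfl⟩
    rw [Category.assoc, h.w, ← Category.assoc, ht.hom_ext (y ≫ _) (ht.from T)]
  · have hs (s : PullbackCone χ τ) : ∃ y : s.pt ⟶ U, y ≫ m = s.fst := by
      rw [h, s.condition, ht.hom_ext s.snd (ht.from _)]
    choose y hy using hs
    refine ⟨⟨(h m).1 ⟨𝟙 _, Category.id_comp _⟩⟩, ⟨PullbackCone.IsLimit.mk _ y hy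
      (fun s => ht.hom_ext _ _) (fun s k hk _ => ?_)⟩⟩
    rw [← cancel_mono m, hk, hy]

/-- A subobject classifier of a dense full subcategory closed under finite limits and subobjects
is a subobject classifier of the ambient category. -/
lemma exists_classifier [HasFiniteLimits E] [HasFiniteLimits F] [i.Full] [i.Faithful]
    [PreservesFiniteLimits i] [(inducedTopology i).Subcanonical]
    (hsub : SubobjectClosed i) (c : Subobject.Classifier E) :
    ∃ c' : Subobject.Classifier F, Nonempty (Arrow.mk (i.map c.truth) ≅ Arrow.mk c'.truth) := by
  have ht : IsTerminal (i.obj c.Ω₀) := IsTerminal.isTerminalObj i _ c.isTerminalΩ₀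
  have key {U X : F} (m : U ⟶ X) [Mono m] : ∃! χ : X ⟶ i.obj c.Ω,
      IsPullback m (ht.from U) χ (i.map c.truth) := by
    -- Classify the pullback of `m` along each point `g`; uniqueness will make these characteristic
    -- maps natural in `g`.
    have h₁ (A : E) (g : i.obj A ⟶ X) : ∃! χ : i.obj A ⟶ i.obj c.Ω, ∀ {T : F} (x : T ⟶ i.obj A),
        (∃ y : T ⟶ U, y ≫ m = x ≫ g) ↔ x ≫ χ = ht.from T ≫ i.map c.truth := by
      have h₀ {T : F} (x : T ⟶ i.obj A) : (∃ y : T ⟶ U, y ≫ m = x ≫ g) ↔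
          ∃ y : T ⟶ pullback m g, y ≫ pullback.snd m g = x :=
        ⟨fun ⟨y, hy⟩ => ⟨pullback.lift y x hy, pullback.lift_snd _ _ _⟩, fun ⟨y, hy⟩ =>
          ⟨y ≫ pullback.fst m g, by rw [Category.assoc, pullback.condition, reassoc_of% hy]⟩⟩
      simp only [h₀, ← isPullback_from_iff ht]
      obtain ⟨χ, ⟨u, hu⟩, hχ⟩ := existsUnique_char hsub c (pullback.snd m g)
      refine ⟨χ, ?_, fun χ' hχ' => hχ _ ⟨_, hχ'⟩⟩
      rwa [ht.hom_ext u (ht.from _)] at hu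
    choose χ hχ hχ' using h₁
    have hχ₁ (A : E) (g : i.obj A ⟶ X) :
        (∃ y : i.obj A ⟶ U, y ≫ m = g) ↔ χ A g = ht.from _ ≫ i.map c.truth := by
      simpa using hχ A g (𝟙 _)
    obtain ⟨t, ht'⟩ := exists_hom_of_points i χ fun {A B} a g => by
      refine (hχ' _ _ _ fun x => ?_).symm
      rw [← Category.assoc, ← Category.assoc]
      exact hχ B g (x ≫ i.map a)
    simp only [isPullback_from_iff ht]
    refine ⟨t, fun {T} x => ⟨?_, fun hx => ?_⟩, fun t' h' => ?_⟩
    · rintro ⟨y, rfl⟩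
      refine hom_ext_of_points i fun A a => ?_
      rw [← Category.assoc a (ht.from T), ht.hom_ext (a ≫ ht.from T) (ht.from _),
        ← Category.assoc, ht', ← hχ₁]
      exact ⟨a ≫ y, Category.assoc _ _ _⟩
    -- Each point of `T` lifts to `U`; the lifts are unique because `m` is mono, hence they glue.
    · have h (A : E) (a : i.obj A ⟶ T) : ∃ y : i.obj A ⟶ U, y ≫ m = a ≫ x := by
        rw [hχ₁, ← ht', Category.assoc, hx, ← Category.assoc]
        congr 1
        exact ht.hom_ext _ _
      choose k hk using h
      obtain ⟨y, hy⟩ := exists_hom_of_points i k fun {A B} a g => by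
        rw [← cancel_mono m, hk, Category.assoc, Category.assoc, hk]
      exact ⟨y, hom_ext_of_points i fun A a => by rw [← Category.assoc, hy, hk]⟩
    · refine hom_ext_of_points i fun A a => ?_
      rw [ht']
      refine hχ' _ _ _ fun x => ?_
      rw [← Category.assoc]
      exact h' (x ≫ a)
  choose χ hχ hχ' using @key
  exact ⟨.mkOfTerminalΩ₀ _ ht _ (i.map c.truth) χ hχ hχ', ⟨Iso.refl _⟩⟩

end Density
-- Coalgebras of a Cartesian comonad form a topos
section Coalgebras

variable {F : Type u₂} [Category.{v₂} F] {H : Comonad F}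

lemma hasFiniteLimits_coalgebra [HasFiniteLimits F] [PreservesFiniteLimits H.toFunctor] :
    HasFiniteLimits H.Coalgebra :=
  ⟨fun _ _ _ => ⟨fun _ => Comonad.forget_creates_limits_of_comonad_preserves _⟩⟩

lemma preservesFiniteLimits_forget [HasFiniteLimits F] [PreservesFiniteLimits H.toFunctor] :
    PreservesFiniteLimits H.forget :=
  ⟨fun _ _ _ => inferInstance⟩

lemma isLeftAdjoint_prod_of_isExponential [HasBinaryProducts F] (A : F)
    (h : ∀ B : F, ∃ (X : F) (ev : A ⨯ X ⟶ B), IsExponential ev) :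
    (prod.functor.obj A).IsLeftAdjoint := by
  choose X ev hev using h
  choose g hg hg' using hev
  let e (Z B : F) : (A ⨯ Z ⟶ B) ≃ (Z ⟶ X B) :=
    { toFun f := g B Z f
      invFun k := prod.map (𝟙 A) k ≫ ev B
      left_inv f := hg B Z f
      right_inv k := (hg' B Z _ k rfl).symm }
  exact (Adjunction.adjunctionOfEquivRight (G_obj := X) (F := prod.functor.obj A) e
    (fun Z' Z B a b => (hg' B Z' _ _ (by
      have h : prod.map (𝟙 A) (a ≫ g B Z b) = prod.map (𝟙 A) a ≫ prod.map (𝟙 A) (g B Z b) := by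
        simp
      exact (congrArg (· ≫ ev B) h).trans ((Category.assoc _ _ _).trans
        (congrArg (prod.map (𝟙 A) a ≫ ·) (hg B Z b))))).symm)).isLeftAdjoint

lemma exists_exponential_of_isLeftAdjoint [HasBinaryProducts F] (A B : F)
    (h : (prod.functor.obj A).IsLeftAdjoint) :
    ∃ (X : F) (ev : A ⨯ X ⟶ B), IsExponential ev := by
  let adj := Adjunction.ofIsLeftAdjoint (prod.functor.obj A)
  refine ⟨_, adj.counit.app B, fun Z f => ⟨adj.homEquiv Z B f, ?_, fun k hk => ?_⟩⟩
  · have := (adj.homEquiv Z B).symm_apply_apply f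
    rwa [adj.homEquiv_counit] at this
  · exact (Equiv.symm_apply_eq _).1 ((adj.homEquiv_counit _ _ _).trans hk)

/-- Adjoint lifting: the comonadic forgetful functor intertwines the product with `A` and the
product with `A.A`, and the latter has a right adjoint. -/
lemma exists_exponential_coalgebra [IsElementaryTopos F] [PreservesFiniteLimits H.toFunctor]
    [HasFiniteLimits H.Coalgebra] (A B : H.Coalgebra) :
    ∃ (X : H.Coalgebra) (ev : A ⨯ X ⟶ B), IsExponential ev := by
  have := preservesFiniteLimits_forget (H := H)
  have := isLeftAdjoint_prod_of_isExponential A.A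
    (IsElementaryTopos.exists_exponential (C := F) A.A)
  have := H.adj.isLeftAdjoint
  refine exists_exponential_of_isLeftAdjoint A B ?_
  refine isLeftAdjoint_square_lift_comonadic (prod.functor.obj A) H.forget H.forget
    (prod.functor.obj A.A) (prodComparisonNatIso H.forget A).symm

lemma Classifier.eq_χ_iff (c : Subobject.Classifier F) {U X : F} (m : U ⟶ X) [Mono m]
    (χ : X ⟶ c.Ω) : χ = c.χ m ↔
      ∀ {T : F} (x : T ⟶ X), (∃ y : T ⟶ U, y ≫ m = x) ↔ x ≫ χ = c.χ₀ T ≫ c.truth := by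
  rw [← c.isTerminalFrom_eq_χ₀, ← isPullback_from_iff c.isTerminalΩ₀]
  refine ⟨?_, fun h => c.uniq m h⟩
  rintro rfl
  exact c.isPullback m

/-- The cofree coalgebra on an object. -/
abbrev cofreeCoalgebra (H : Comonad F) (X : F) : H.Coalgebra where
  A := H.obj X
  a := H.δ.app X
  coassoc := (H.coassoc _).symm

/-- The morphism of coalgebras to a cofree coalgebra induced by a morphism of the base category. -/
@[simps]
def cofreeLift {Z : H.Coalgebra} {X : F} (k : Z.A ⟶ X) : Z ⟶ cofreeCoalgebra H X where
  f := Z.a ≫ H.map k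
  h := by
    have := H.δ.naturality k
    dsimp only [Functor.comp_map] at this
    rw [Category.assoc, this, reassoc_of% Z.coassoc, H.map_comp]

lemma cofreeLift_ε {Z : H.Coalgebra} {X : F} (k : Z.A ⟶ X) :
    (cofreeLift k).f ≫ H.ε.app X = k := by
  have := H.ε.naturality k
  dsimp only [Functor.id_map] at this
  rw [cofreeLift_f, Category.assoc, this, Z.counit_assoc]

lemma cofree_hom_ext {Z : H.Coalgebra} {X : F} {k k' : Z ⟶ cofreeCoalgebra H X}
    (h : k.f ≫ H.ε.app X = k'.f ≫ H.ε.app X) : k = k' := by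
  have (l : Z ⟶ cofreeCoalgebra H X) : l.f = Z.a ≫ H.map (l.f ≫ H.ε.app X) := by
    rw [H.map_comp, reassoc_of% l.h, H.right_counit]
    exact (Category.comp_id _).symm
  ext
  rw [this k, this k', h]

/-- As `H.map m.f` is mono, a lift in the base category is automatically a coalgebra morphism. -/
lemma exists_coalgebra_lift [HasFiniteLimits F] [PreservesFiniteLimits H.toFunctor]
    {T U X : H.Coalgebra} (m : U ⟶ X) [Mono m.f] (x : T ⟶ X) :
    (∃ y : T ⟶ U, y ≫ m = x) ↔ ∃ y : T.A ⟶ U.A, y ≫ m.f = x.f := by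
  refine ⟨fun ⟨y, hy⟩ => ⟨y.f, congr_arg (fun k => k.f) hy⟩, fun ⟨y, hy⟩ => ⟨⟨y, ?_⟩, ?_⟩⟩
  · rw [← cancel_mono (H.map m.f), Category.assoc, Category.assoc, ← H.map_comp, hy, m.h,
      reassoc_of% hy, x.h]
  · ext
    exact hy

/-- Coalgebra morphisms from `X` to the cofree coalgebra on `Ω` correspond to subobjects of `X.A`.
With `j` classifying `H.map τ`, such a morphism equalizes `r` and the identity exactly when the
subobject is the inverse image of its `H`-image along `X.a`. Subcoalgebras have this property, so
the equalizer is the classifier. -/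
lemma hasSubobjectClassifier_coalgebra [HasFiniteLimits F] [HasSubobjectClassifier F]
    [PreservesFiniteLimits H.toFunctor] : HasSubobjectClassifier H.Coalgebra := by
  have := hasFiniteLimits_coalgebra (H := H)
  have := preservesFiniteLimits_forget (H := H)
  obtain ⟨c⟩ := HasSubobjectClassifier.exists_classifier (C := F)
  have hc {T T' : F} (a : T ⟶ T') : a ≫ c.χ₀ T' ≫ c.truth = c.χ₀ T ≫ c.truth := by
    rw [← Category.assoc]
    congr 1
    exact c.isTerminalΩ₀.hom_ext _ _
  have ht : IsTerminal (⊤_ H.Coalgebra) := terminalIsTerminal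
  have ht' : IsTerminal (⊤_ H.Coalgebra).A := IsTerminal.isTerminalObj H.forget _ ht
  have ht'' : IsTerminal (H.obj (⊤_ H.Coalgebra).A) := IsTerminal.isTerminalObj H.toFunctor _ ht'
  generalize (⊤_ H.Coalgebra) = I at ht ht' ht''
  let τ : I.A ⟶ c.Ω := c.χ₀ I.A ≫ c.truth
  have : Mono τ := ht'.mono_from _
  let j : H.obj c.Ω ⟶ c.Ω := c.χ (H.map τ)
  have hj {T : F} (x : T ⟶ H.obj c.Ω) :
      (∃ y, y ≫ H.map τ = x) ↔ x ≫ j = c.χ₀ T ≫ c.truth :=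
    (Classifier.eq_χ_iff c (H.map τ) j).1 rfl x
  let r : cofreeCoalgebra H c.Ω ⟶ cofreeCoalgebra H c.Ω := cofreeLift (Z := cofreeCoalgebra H c.Ω) j
  let θ : I ⟶ cofreeCoalgebra H c.Ω := cofreeLift τ
  have hr {Z : H.Coalgebra} (k : Z ⟶ cofreeCoalgebra H c.Ω) :
      k ≫ r = k ≫ 𝟙 _ ↔ k.f ≫ j = k.f ≫ H.ε.app _ := by
    have e : (k ≫ r).f ≫ H.ε.app _ = k.f ≫ j := by
      rw [Comonad.Coalgebra.comp_f, Category.assoc]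
      congr 1
      exact cofreeLift_ε (Z := cofreeCoalgebra H c.Ω) j
    rw [Category.comp_id, ← e]
    exact ⟨fun h => by rw [h], fun h => cofree_hom_ext h⟩
  have hθ : θ ≫ r = θ ≫ 𝟙 _ := by
    rw [hr, cofreeLift_ε, (hj θ.f).1 ⟨I.a, rfl⟩]
  let truth : I ⟶ equalizer r (𝟙 _) := equalizer.lift θ hθ
  have htruth {X T : H.Coalgebra} (χ : X ⟶ equalizer r (𝟙 _)) (x : T ⟶ X) :
      x ≫ χ = ht.from T ≫ truth ↔
        x.f ≫ (χ ≫ equalizer.ι r (𝟙 _)).f ≫ H.ε.app _ = c.χ₀ _ ≫ c.truth := by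
    rw [← cancel_mono (equalizer.ι r (𝟙 _)), Category.assoc, Category.assoc,
      equalizer.lift_ι]
    have e : (ht.from T ≫ θ).f ≫ H.ε.app _ = c.χ₀ _ ≫ c.truth := by
      rw [Comonad.Coalgebra.comp_f, Category.assoc, cofreeLift_ε, hc]
    have e' : (x ≫ χ ≫ equalizer.ι r (𝟙 _)).f ≫ H.ε.app _ =
        x.f ≫ (χ ≫ equalizer.ι r (𝟙 _)).f ≫ H.ε.app _ := by
      rw [Comonad.Coalgebra.comp_f, Category.assoc]
    rw [← e, ← e']
    exact ⟨fun h => by rw [h], fun h => cofree_hom_ext h⟩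
  -- `U` is the inverse image of `H U` along `X.a`: one inclusion holds because `m` is a coalgebra
  -- morphism, the other by lifting to `H U` and applying the counit.
  have hfac {U X : H.Coalgebra} (m : U ⟶ X) [Mono m.f] : (X.a ≫ H.map (c.χ m.f)) ≫ j = c.χ m.f := by
    rw [Classifier.eq_χ_iff]
    intro T x
    rw [← Category.assoc x, ← hj]
    have hp : IsPullback m.f (ht'.from _) (c.χ m.f) τ := by
      rw [isPullback_from_iff]
      intro S s
      rw [hc]
      exact (Classifier.eq_χ_iff c m.f _).1 rfl s
    refine ⟨fun ⟨y, hy⟩ => ⟨y ≫ U.a ≫ H.map (ht'.from _), ?_⟩, fun ⟨y, hy⟩ => ?_⟩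
    · rw [Category.assoc, Category.assoc, ← H.map_comp, ← hp.w, H.map_comp, ← hy, m.h_assoc,
        Category.assoc]
    · rw [← Category.assoc] at hy
      refine ⟨(hp.map H.toFunctor).lift (x ≫ X.a) y hy.symm ≫ H.ε.app _, ?_⟩
      have e := (hp.map H.toFunctor).lift_fst (x ≫ X.a) y hy.symm
      have e' := H.ε.naturality m.f
      dsimp only [Functor.id_map] at e'
      rw [Category.assoc, ← e', reassoc_of% e, X.counit, Category.comp_id]
  have key {U X : H.Coalgebra} (m : U ⟶ X) [Mono m] : ∃! χ : X ⟶ equalizer r (𝟙 _),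
      IsPullback m (ht.from U) χ truth := by
    have : Mono m.f := inferInstanceAs (Mono (H.forget.map m))
    have e : cofreeLift (c.χ m.f) ≫ r = cofreeLift (c.χ m.f) ≫ 𝟙 _ := by
      rw [hr, cofreeLift_ε]
      exact hfac m
    simp only [isPullback_from_iff]
    refine ⟨equalizer.lift _ e, fun {T} x => ?_, fun χ' h => ?_⟩
    · rw [htruth, equalizer.lift_ι, cofreeLift_ε, exists_coalgebra_lift]
      exact (Classifier.eq_χ_iff c m.f _).1 rfl x.f
    · rw [← cancel_mono (equalizer.ι r (𝟙 _)), equalizer.lift_ι]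
      refine cofree_hom_ext ?_
      rw [cofreeLift_ε, Classifier.eq_χ_iff]
      intro T x
      have hp : IsPullback m (ht.from U) (χ' ≫ equalizer.ι r (𝟙 _)) θ := by
        rw [isPullback_from_iff]
        intro S s
        rw [h, ← cancel_mono (equalizer.ι r (𝟙 _)), Category.assoc, Category.assoc,
          equalizer.lift_ι]
      replace hp : IsPullback m.f (ht.from U).f (χ' ≫ equalizer.ι r (𝟙 _)).f θ.f :=
        hp.map H.forget
      have hχ' : (χ' ≫ equalizer.ι r (𝟙 _)).f ≫ j = (χ' ≫ equalizer.ι r (𝟙 _)).f ≫ H.ε.app _ := by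
        rw [← hr, Category.assoc, Category.assoc, equalizer.condition]
      rw [← hχ', ← Category.assoc, ← hj]
      -- Since `H.obj I.A` is terminal, factoring through `H.map τ` is the same as factoring through
      -- `θ.f`.
      refine ⟨fun ⟨y, hy⟩ => ⟨y ≫ ht'.from _ ≫ I.a, ?_⟩, fun ⟨y, hy⟩ => ?_⟩
      · rw [← hy, Category.assoc, Category.assoc, Category.assoc, hp.w,
          ht'.hom_ext (ht'.from _) (ht.from U).f]
        simp [θ]
      · refine ⟨hp.lift x (ht'.from _) ?_, hp.lift_fst _ _ _⟩
        rw [← hy, cofreeLift_f, ← Category.assoc, ht''.hom_ext y (ht'.from T ≫ I.a)]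
  choose χ hχ hχ' using @key
  exact ⟨⟨.mkOfTerminalΩ₀ _ ht _ truth χ hχ hχ'⟩⟩

/-- The coalgebras of a Cartesian comonad on a topos form a topos. -/
lemma isElementaryTopos_coalgebra [IsElementaryTopos F] [PreservesFiniteLimits H.toFunctor] :
    IsElementaryTopos H.Coalgebra :=
  have := hasFiniteLimits_coalgebra (H := H)
  have := hasSubobjectClassifier_coalgebra (H := H)
  { exists_exponential := exists_exponential_coalgebra }

end Coalgebras
-- The induced functor on coalgebras: logical closure and density
section CoalgebraFunctor

variable {E : Type u₁} [Category.{v₁} E] {F : Type u₂} [Category.{v₂} F] {i : E ⥤ F}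

/-- The characteristic map goes between objects of `E`, since `i` preserves the classifier. By
fullness it comes from `E`, and so does the pullback of truth along it. -/
lemma IsLogicalInclusion.subobjectClosed [IsElementaryTopos E] [IsElementaryTopos F]
    (h : IsLogicalInclusion i) : SubobjectClosed i := by
  have := h.full
  have := h.preservesFiniteLimits
  intro A U m _
  obtain ⟨c⟩ := HasSubobjectClassifier.exists_classifier (C := E)
  obtain ⟨c', ⟨e⟩⟩ := h.classifier c
  obtain ⟨χ, hχ⟩ := i.map_surjective (c'.χ m ≫ e.inv.right)
  have h₁ : IsPullback m (c'.χ₀ U ≫ e.inv.left) (i.map χ) (i.map c.truth) := by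
    refine (c'.isPullback m).of_iso (Iso.refl _) (Iso.refl _) (Arrow.leftFunc.mapIso e).symm
      (Arrow.rightFunc.mapIso e).symm (by simp) ?_ ?_ ?_
    · exact (Category.id_comp _).symm
    · rw [hχ]
      exact (Category.id_comp _).symm
    · exact e.inv.w.symm
  exact ⟨pullback χ c.truth, ⟨h₁.isoIsPullback _ _ ((IsPullback.of_hasPullback χ c.truth).map i)⟩⟩

variable {G : Comonad E} {H : Comonad F} (φ : ComonadMorphism i G H)

lemma ComonadMorphism.τ_naturality {A B : E} (f : A ⟶ B) :
    φ.τ.hom.app A ≫ H.map (i.map f) = i.map (G.map f) ≫ φ.τ.hom.app B :=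
  (φ.τ.hom.naturality f).symm

lemma ComonadMorphism.faithful_coalg [i.Faithful] : φ.coalg.Faithful where
  map_injective h := by
    ext
    exact i.map_injective (congr_arg (fun k => k.f) h)

lemma ComonadMorphism.full_coalg [i.Full] [i.Faithful] : φ.coalg.Full where
  map_surjective {A B} f := by
    let f' : i.obj A.A ⟶ i.obj B.A := f.f
    obtain ⟨k, hk⟩ := i.map_surjective f'
    refine ⟨⟨k, i.map_injective ?_⟩, ?_⟩
    · have h : (i.map A.a ≫ φ.τ.hom.app A.A) ≫ H.map f' = f' ≫ i.map B.a ≫ φ.τ.hom.app B.A := f.h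
      have e : IsIso (φ.τ.hom.app B.A) := inferInstance
      rw [← hk, Category.assoc, φ.τ_naturality, ← Category.assoc, ← Category.assoc] at h
      rw [i.map_comp, i.map_comp]
      exact (cancel_mono _).1 h
    · ext
      exact hk

lemma ComonadMorphism.injective_obj_coalg [i.Faithful] (hi : Function.Injective i.obj) :
    Function.Injective φ.coalg.obj := by
  rintro ⟨A, a, _, _⟩ ⟨B, b, _, _⟩ h
  obtain rfl : A = B := hi (congr_arg (fun X => X.A) h)
  have h' : i.map a ≫ φ.τ.hom.app A = i.map b ≫ φ.τ.hom.app A := by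
    simpa [ComonadMorphism.coalg] using h
  obtain rfl : a = b := i.map_injective ((cancel_mono _).1 h')
  rfl

lemma ComonadMorphism.preservesFiniteLimits_coalg [HasFiniteLimits E] [HasFiniteLimits F]
    [PreservesFiniteLimits G.toFunctor] [PreservesFiniteLimits H.toFunctor]
    [PreservesFiniteLimits i] : PreservesFiniteLimits φ.coalg where
  preservesFiniteLimits J _ _ := by
    have := preservesFiniteLimits_forget (H := G)
    have : PreservesLimitsOfShape J (φ.coalg ⋙ H.forget) :=
      inferInstanceAs (PreservesLimitsOfShape J (G.forget ⋙ i))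
    exact preservesLimitsOfShape_of_reflects_of_preserves φ.coalg H.forget

/-- The underlying object is isomorphic to some `i.obj B`. Transporting the structure map there and
undoing `τ` gives a morphism in the image of the full functor `i`; the coalgebra laws hold because
`i` is faithful. -/
lemma ComonadMorphism.subobjectClosed_coalg [HasFiniteLimits F] [i.Full] [i.Faithful]
    [PreservesFiniteLimits H.toFunctor] (h : SubobjectClosed i) : SubobjectClosed φ.coalg := by
  have := preservesFiniteLimits_forget (H := H)
  intro A U m _
  let m' : U.A ⟶ i.obj A.A := m.f
  have : Mono m' := inferInstanceAs (Mono (H.forget.map m))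
  obtain ⟨B, ⟨e⟩⟩ := h m'
  obtain ⟨b, hb⟩ := i.map_surjective (e.inv ≫ U.a ≫ H.map e.hom ≫ φ.τ.inv.app B)
  have hb' : i.map b ≫ φ.τ.hom.app B = e.inv ≫ U.a ≫ H.map e.hom := by
    rw [hb]
    simp
  let B' : G.Coalgebra :=
    { A := B
      a := b
      counit := i.map_injective (by
        have h := H.ε.naturality e.hom
        dsimp only [Functor.id_map] at h
        rw [i.map_comp, ← φ.counit, reassoc_of% hb', h, U.counit_assoc, i.map_id,
          e.inv_hom_id])
      coassoc := i.map_injective (by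
        have : IsIso (φ.τ.hom.app (G.obj B)) := inferInstance
        have : IsIso (H.map (φ.τ.hom.app B)) := inferInstance
        have h := H.δ.naturality e.hom
        dsimp only [Functor.comp_map] at h
        have h' := φ.comult B
        rw [← cancel_mono (φ.τ.hom.app (G.obj B)), ← cancel_mono (H.map (φ.τ.hom.app B)),
          i.map_comp, i.map_comp, Category.assoc, Category.assoc, ← φ.comult, reassoc_of% hb', h,
          Category.assoc (i.map b)]
        refine Eq.trans ?_ (congr_arg (fun k => i.map b ≫ k ≫ H.map (φ.τ.hom.app B))
          (φ.τ_naturality b) |>.trans (by simp only [Category.assoc]))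
        rw [Category.assoc, ← H.map_comp, hb', reassoc_of% hb']
        simp [U.coassoc_assoc]) }
  refine ⟨B', ⟨Comonad.Coalgebra.isoMk e ?_⟩⟩
  change _ = e.hom ≫ i.map b ≫ φ.τ.hom.app B
  rw [hb', e.hom_inv_id_assoc]
  rfl

lemma hom_f_eq_of_comp_eq {X Y Z : H.Coalgebra} {a : X ⟶ Y} {b : Y ⟶ Z} {c : X ⟶ Z}
    (h : a ≫ b = c) : a.f ≫ b.f = c.f := by
  rw [← h, Comonad.Coalgebra.comp_f]

lemma isPullback_f [HasFiniteLimits F] [PreservesFiniteLimits H.toFunctor]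
    {P X Y Z : H.Coalgebra} {a : P ⟶ X} {b : P ⟶ Y} {c : X ⟶ Z} {d : Y ⟶ Z}
    (h : IsPullback a b c d) : IsPullback a.f b.f c.f d.f :=
  have := preservesFiniteLimits_forget (H := H)
  h.map H.forget

lemma isPullback_of_f [HasFiniteLimits F] [PreservesFiniteLimits H.toFunctor]
    {P X Y Z : H.Coalgebra} {a : P ⟶ X} {b : P ⟶ Y} {c : X ⟶ Z} {d : Y ⟶ Z}
    (h : IsPullback a.f b.f c.f d.f) : IsPullback a b c d :=
  IsPullback.of_map H.forget (by ext; exact h.w) h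

/-- Every morphism `i.obj A ⟶ X` to a coalgebra `X` factors through a morphism of coalgebras from an
object in the image of `φ.coalg`. -/
lemma ComonadMorphism.exists_factorization [HasFiniteLimits F] [i.Full] [i.Faithful]
    [PreservesFiniteLimits H.toFunctor] (h : SubobjectClosed i)
    (hsite : IsMorphismOfSites i i H.toFunctor) {A : E} {X : H.Coalgebra} (f : i.obj A ⟶ X.A) :
    ∃ (B : G.Coalgebra) (g : φ.coalg.obj B ⟶ X) (k : i.obj A ⟶ (φ.coalg.obj B).A),
      k ≫ g.f = f := by
  have := hasFiniteLimits_coalgebra (H := H)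
  have := preservesFiniteLimits_forget (H := H)
  obtain ⟨B, g, k, hk⟩ := hsite _ A (f ≫ X.a)
  let s : X ⟶ cofreeCoalgebra H X.A := cofreeLift (𝟙 _)
  have hs : s.f = X.a := by
    rw [cofreeLift_f, H.map_id]
    exact Category.comp_id _
  have : Mono s := by
    have : Mono s.f := by
      have : Mono (s.f ≫ H.ε.app X.A) := by
        rw [cofreeLift_ε]
        infer_instance
      exact mono_of_mono _ (H.ε.app X.A)
    exact H.forget.mono_of_mono_map this
  -- The transpose of `i.map (G.ε.app B) ≫ g`, chosen so that its underlying morphism is `H.map g`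
  -- up to `τ`.
  let t : φ.coalg.obj (cofreeCoalgebra G B) ⟶ cofreeCoalgebra H X.A :=
    cofreeLift (show i.obj (G.obj B) ⟶ X.A from i.map (G.ε.app B) ≫ g)
  have ht : t.f = φ.τ.hom.app B ≫ H.map g := by
    change (i.map (G.δ.app B) ≫ φ.τ.hom.app (G.obj B)) ≫ H.map (i.map (G.ε.app B) ≫ g) = _
    rw [H.map_comp, Category.assoc, reassoc_of% φ.τ_naturality (G.ε.app B), ← i.map_comp_assoc,
      G.right_counit, i.map_id]
    exact Category.id_comp _
  -- `s` is mono, so the pullback is a subobject of an object in the image of `φ.coalg`.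
  obtain ⟨Q, ⟨e⟩⟩ := φ.subobjectClosed_coalg h (pullback.snd s t)
  have hp := isPullback_f (IsPullback.of_hasPullback s t)
  have hw : f ≫ s.f = (k ≫ φ.τ.inv.app B) ≫ t.f := by
    rw [hs, ht, ← hk]
    simp
  refine ⟨Q, e.inv ≫ pullback.fst s t, hp.lift f (k ≫ φ.τ.inv.app B) hw ≫ e.hom.f, ?_⟩
  have he : e.hom.f ≫ (e.inv ≫ pullback.fst s t).f = (pullback.fst s t).f :=
    hom_f_eq_of_comp_eq (by simp)
  rw [Category.assoc, he]
  exact hp.lift_fst _ _ _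

section

variable [HasFiniteLimits F] [i.Full] [i.Faithful] [PreservesFiniteLimits H.toFunctor]

lemma ComonadMorphism.ofArrows_f_mem (h : SubobjectClosed i)
    (hsite : IsMorphismOfSites i i H.toFunctor) {ι : Type*} {X : H.Coalgebra} {Z : ι → H.Coalgebra}
    {f : ∀ j, Z j ⟶ X} (hf : Sieve.ofArrows Z f ∈ inducedTopology φ.coalg X) :
    Sieve.ofArrows (fun j => (Z j).A) (fun j => (f j).f) ∈ inducedTopology i X.A := by
  intro A x
  obtain ⟨B, g, k, rfl⟩ := φ.exists_factorization h hsite x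
  obtain ⟨_, w, _, ⟨j⟩, rfl⟩ := hf B g
  exact ⟨_, k ≫ w.f, _, .mk j, Category.assoc _ _ _⟩

/-- Here `t` and `t'` are mere morphisms of `F`, so the lemma can verify the coalgebra morphism
equation of a glued map. -/
lemma ComonadMorphism.hom_ext_of_points_coalg (h : SubobjectClosed i)
    (hsite : IsMorphismOfSites i i H.toFunctor) [(inducedTopology i).Subcanonical]
    {X : H.Coalgebra} {T : F} {t t' : X.A ⟶ T}
    (ht : ∀ (A : G.Coalgebra) (g : φ.coalg.obj A ⟶ X), g.f ≫ t = g.f ≫ t') : t = t' :=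
  hom_ext_of_points i fun A x => by
    obtain ⟨B, g, k, rfl⟩ := φ.exists_factorization h hsite x
    rw [Category.assoc, ht, Category.assoc]

/-- The underlying morphisms of the coalgebra points cover `X.A`; values on them glue in `F`, and
the result is checked on points to be a coalgebra morphism. -/
lemma ComonadMorphism.isDense_coalg (h : SubobjectClosed i)
    (hsite : IsMorphismOfSites i i H.toFunctor) [(inducedTopology i).Subcanonical] :
    φ.coalg.IsDense := by
  have := hasFiniteLimits_coalgebra (H := H)
  have := φ.full_coalg
  refine isDense_of_points _ (fun {X T t t'} ht => ?_) (fun {X T} k hk => ?_)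
  · ext
    exact φ.hom_ext_of_points_coalg h hsite fun A g =>
      congr_arg Comonad.Coalgebra.Hom.f (ht A g)
  · have hcov : Sieve.ofArrows _
        (fun g : Σ A : G.Coalgebra, (φ.coalg.obj A ⟶ X) => g.2.f) ∈ inducedTopology i X.A :=
      φ.ofArrows_f_mem h hsite (f := fun g : Σ A : G.Coalgebra, (φ.coalg.obj A ⟶ X) => g.2)
        fun A g => ⟨_, 𝟙 _, _, .mk (⟨A, g⟩ : Σ A : G.Coalgebra, (φ.coalg.obj A ⟶ X)),
          Category.id_comp _⟩
    obtain ⟨t, ht⟩ := exists_glue _ hcov (fun g => (k g.1 g.2).f) (by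
      intro W g g' a b hab
      -- `W` carries no coalgebra structure, but `a` and `b` factor through the pullback of
      -- coalgebras, whose coalgebra points are available for testing.
      have hp := isPullback_f (IsPullback.of_hasPullback g.2 g'.2)
      have e : (pullback.fst g.2 g'.2).f ≫ (k g.1 g.2).f =
          (pullback.snd g.2 g'.2).f ≫ (k g'.1 g'.2).f :=
        φ.hom_ext_of_points_coalg h hsite fun D d => by
          rw [← Category.assoc, ← Category.assoc, ← Comonad.Coalgebra.comp_f,
            ← Comonad.Coalgebra.comp_f, ← Comonad.Coalgebra.comp_f, ← Comonad.Coalgebra.comp_f]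
          congr 1
          obtain ⟨a', ha'⟩ := φ.coalg.map_surjective (d ≫ pullback.fst g.2 g'.2)
          obtain ⟨b', hb'⟩ := φ.coalg.map_surjective (d ≫ pullback.snd g.2 g'.2)
          rw [← ha', ← hb', ← hk, ← hk, ha', hb', Category.assoc, pullback.condition,
            Category.assoc]
      rw [← hp.lift_fst a b hab, Category.assoc, e, ← Category.assoc, hp.lift_snd])
    refine ⟨⟨t, φ.hom_ext_of_points_coalg h hsite fun A g => ?_⟩, fun A g => ?_⟩
    · have h₁ := ht ⟨A, g⟩
      dsimp only at h₁
      rw [← Category.assoc, ← g.h, Category.assoc, ← H.map_comp, h₁, reassoc_of% h₁]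
      exact (k A g).h
    · ext
      exact ht ⟨A, g⟩

end

end CoalgebraFunctor
-- Descent data of coalgebras and their underlying data
noncomputable section CoalgebraDescent

universe t

lemma f_eq_of_square
    {F : Type u₂} [Category.{v₂} F] {H : Comonad F} {P A B Q : H.Coalgebra}
    {a : P ⟶ A} {b : P ⟶ B} {c : A ⟶ Q} {d : B ⟶ Q}
    (h : a ≫ c = b ≫ d) : a.f ≫ c.f = b.f ≫ d.f := by
  rw [hom_f_eq_of_comp_eq h, Comonad.Coalgebra.comp_f]

variable {F : Type u₂} [Category.{v₂} F] [HasFiniteLimits F] {H : Comonad F}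
  [PreservesFiniteLimits H.toFunctor] {ι : Type t} {X : H.Coalgebra} {Z : ι → H.Coalgebra}
  {f : ∀ j, Z j ⟶ X}

namespace OverDescent

variable [HasPullbacks H.Coalgebra] (D : OverDescent f)

/-- The transport of the universal element of `D.Y i` over `Z j`. -/
def univTr (i j : ι) : pullback (D.p i ≫ f i) (f j) ⟶ D.Y j :=
  D.tr (pullback.fst _ _) (pullback.snd _ _) pullback.condition

lemma isPullback_fst_f (i j : ι) :
    IsPullback (pullback.fst (D.p i ≫ f i) (f j)).f (pullback.snd (D.p i ≫ f i) (f j)).f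
      ((D.p i).f ≫ (f i).f) (f j).f :=
  isPullback_f (IsPullback.of_hasPullback (D.p i ≫ f i) (f j))

/-- The transport of elements of the underlying objects. -/
def trF {T : F} {i j : ι} (y : T ⟶ (D.Y i).A) (z : T ⟶ (Z j).A)
    (h : y ≫ (D.p i).f ≫ (f i).f = z ≫ (f j).f) : T ⟶ (D.Y j).A :=
  (D.isPullback_fst_f i j).lift y z h ≫ (D.univTr i j).f

lemma trF_congr {T : F} {i j : ι} {y y' : T ⟶ (D.Y i).A} {z z' : T ⟶ (Z j).A} (hy : y = y')
    (hz : z = z') (h : y ≫ (D.p i).f ≫ (f i).f = z ≫ (f j).f) :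
    D.trF y z h = D.trF y' z' (by rw [← hy, ← hz, h]) := by
  subst hy hz
  rfl

lemma comp_trF {T T' : F} {i j : ι} (g : T' ⟶ T) (y : T ⟶ (D.Y i).A) (z : T ⟶ (Z j).A)
    (h : y ≫ (D.p i).f ≫ (f i).f = z ≫ (f j).f) :
    g ≫ D.trF y z h = D.trF (g ≫ y) (g ≫ z) (by rw [Category.assoc, h, Category.assoc]) := by
  rw [trF, trF, ← Category.assoc]
  congr 1
  apply (D.isPullback_fst_f i j).hom_ext
  · rw [Category.assoc, IsPullback.lift_fst, IsPullback.lift_fst]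
  · rw [Category.assoc, IsPullback.lift_snd, IsPullback.lift_snd]

lemma trF_f {T : H.Coalgebra} {i j : ι} (y : T ⟶ D.Y i) (z : T ⟶ Z j)
    (h : y ≫ D.p i ≫ f i = z ≫ f j) :
    D.trF y.f z.f (f_eq_of_square h) = (D.tr y z h).f := by
  have e : pullback.lift y z h ≫ D.univTr i j = D.tr y z h := by
    rw [univTr, D.comp_tr]
    exact D.tr_congr (pullback.lift_fst _ _ _) (pullback.lift_snd _ _ _) _
  refine Eq.trans (congr_arg (· ≫ (D.univTr i j).f) ?_) (hom_f_eq_of_comp_eq e)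
  apply (D.isPullback_fst_f i j).hom_ext
  · exact (IsPullback.lift_fst _ _ _ _).trans
      (hom_f_eq_of_comp_eq (pullback.lift_fst y z h)).symm
  · exact (IsPullback.lift_snd _ _ _ _).trans
      (hom_f_eq_of_comp_eq (pullback.lift_snd y z h)).symm

/-- Transfers identities from `D` to `D.trF`: elements in `F` are restrictions, along arbitrary
morphisms, of generic elements that are coalgebra morphisms. -/
lemma trF_comp_f {T : H.Coalgebra} {S : F} {i j : ι} (g : S ⟶ T.A) (y : T ⟶ D.Y i) (z : T ⟶ Z j)
    (h : y ≫ D.p i ≫ f i = z ≫ f j)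
    (h' : (g ≫ y.f) ≫ (D.p i).f ≫ (f i).f = (g ≫ z.f) ≫ (f j).f) :
    D.trF (g ≫ y.f) (g ≫ z.f) h' = g ≫ (D.tr y z h).f := by
  rw [← D.comp_trF g _ _ (f_eq_of_square h), D.trF_f]

lemma trF_p {T : F} {i j : ι} (y : T ⟶ (D.Y i).A) (z : T ⟶ (Z j).A)
    (h : y ≫ (D.p i).f ≫ (f i).f = z ≫ (f j).f) : D.trF y z h ≫ (D.p j).f = z := by
  have e : (D.univTr i j).f ≫ (D.p j).f = _ := hom_f_eq_of_comp_eq (D.tr_p _ _ _)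
  rw [trF, Category.assoc, e]
  exact IsPullback.lift_snd _ _ _ _

/-- The descent datum in the base category underlying a descent datum of coalgebras. -/
def forgetDatum : OverDescent (fun j => (f j).f) where
  Y j := (D.Y j).A
  p j := (D.p j).f
  tr := D.trF
  tr_p := D.trF_p
  comp_tr := D.comp_trF
  tr_self {T i} y := by
    refine (D.trF_congr (Category.comp_id y).symm rfl _).trans ?_
    refine (D.trF_comp_f y (𝟙 (D.Y i)) (D.p i) (Category.id_comp _) _).trans ?_
    have := D.tr_self (𝟙 (D.Y i))
    rw [D.tr_congr rfl (Category.id_comp (D.p i)).symm, this]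
    exact Category.comp_id y
  tr_tr {T i j k} y z z' h h' := by
    -- The triple `(y, z, z')` is the restriction along `m` of the generic one on an iterated
    -- pullback of coalgebras, where `D.tr_tr` applies.
    have hR := isPullback_f (IsPullback.of_hasPullback
      (pullback.snd (D.p i ≫ f i) (f j) ≫ f j) (f k))
    let l := (D.isPullback_fst_f i j).lift y z h
    have hl : l ≫ (pullback.snd (D.p i ≫ f i) (f j) ≫ f j).f = z' ≫ (f k).f := by
      rw [Comonad.Coalgebra.comp_f, ← Category.assoc, IsPullback.lift_snd, h']
    let m := hR.lift l z' hl
    let y₀ := pullback.fst (pullback.snd (D.p i ≫ f i) (f j) ≫ f j) (f k) ≫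
      pullback.fst (D.p i ≫ f i) (f j)
    let z₀ := pullback.fst (pullback.snd (D.p i ≫ f i) (f j) ≫ f j) (f k) ≫
      pullback.snd (D.p i ≫ f i) (f j)
    let z₁ := pullback.snd (pullback.snd (D.p i ≫ f i) (f j) ≫ f j) (f k)
    have hy₀ : m ≫ y₀.f = y := by
      rw [Comonad.Coalgebra.comp_f, ← Category.assoc, IsPullback.lift_fst, IsPullback.lift_fst]
    have hz₀ : m ≫ z₀.f = z := by
      rw [Comonad.Coalgebra.comp_f, ← Category.assoc, IsPullback.lift_fst, IsPullback.lift_snd]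
    have hz₁ : m ≫ z₁.f = z' := hR.lift_snd _ _ _
    have h₀ : y₀ ≫ D.p i ≫ f i = z₀ ≫ f j := by
      rw [Category.assoc, pullback.condition, Category.assoc]
    have h₁ : z₀ ≫ f j = z₁ ≫ f k := by
      rw [Category.assoc, pullback.condition]
    have e := D.tr_tr y₀ z₀ z₁ h₀ h₁
    refine (D.trF_congr ((D.trF_congr hy₀.symm hz₀.symm _).trans
      (D.trF_comp_f m y₀ z₀ h₀ _)) hz₁.symm _).trans ?_
    refine (D.trF_comp_f m _ z₁ (by rw [← Category.assoc, D.tr_p, h₁]) _).trans ?_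
    rw [e, ← D.trF_comp_f m y₀ z₁ (h₀.trans h₁)]
    · exact D.trF_congr hy₀ hz₁ _
    · rw [hy₀, hz₁, h, h']

/-- The coalgebra structures of the `D.Y j` glue on `W` because the transports are coalgebra
morphisms; the coalgebra laws are checked on the cover `e`. -/
lemma isEffective_of_forget {J : GrothendieckTopology F} [J.Subcanonical]
    (hf : Sieve.ofArrows (fun j => (Z j).A) (fun j => (f j).f) ∈ J X.A)
    (h : D.forgetDatum.IsEffective) : D.IsEffective := by
  obtain ⟨W, q, (e : ∀ j, (D.Y j).A ⟶ W), hp, he⟩ := h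
  replace hp : ∀ j, IsPullback (e j) (D.p j).f q (f j).f := hp
  replace he : ∀ {T : F} {i j : ι} (y : T ⟶ (D.Y i).A) (z : T ⟶ (Z j).A)
    (h : y ≫ (D.p i).f ≫ (f i).f = z ≫ (f j).f), D.trF y z h ≫ e j = y ≫ e i := he
  have hcov : Sieve.ofArrows (fun j => (D.Y j).A) e ∈ J W := baseChange_mem_topology q hf hp
  have hκ (i j : ι) : (D.univTr i j).f ≫ e j = (pullback.fst (D.p i ≫ f i) (f j)).f ≫ e i := by
    rw [univTr, ← D.trF_f]
    exact he _ _ _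
  obtain ⟨w, hw⟩ := exists_glue e hcov (fun j => (D.Y j).a ≫ H.map (e j)) (by
    intro T i j a b hab
    have hz : a ≫ (D.p i).f ≫ (f i).f = (b ≫ (D.p j).f) ≫ (f j).f := by
      rw [← (hp i).w, reassoc_of% hab, (hp j).w, Category.assoc]
    -- Elements with the same image in `W` are transports of each other, so compatibility need only
    -- be checked for the universal transport.
    have hb : b = D.trF a (b ≫ (D.p j).f) hz :=
      (hp j).hom_ext (by rw [he, hab]) (by rw [D.trF_p])
    obtain ⟨l, hl, hl'⟩ : ∃ l, l ≫ (pullback.fst (D.p i ≫ f i) (f j)).f = a ∧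
        l ≫ (D.univTr i j).f = b :=
      ⟨_, (D.isPullback_fst_f i j).lift_fst a (b ≫ (D.p j).f) hz, hb.symm⟩
    rw [← hl, ← hl', Category.assoc, Category.assoc, ← Comonad.Coalgebra.Hom.h_assoc,
      ← Comonad.Coalgebra.Hom.h_assoc, ← H.map_comp, ← H.map_comp, hκ])
  have hwq : w ≫ H.map q = q ≫ X.a := hom_ext_of_cover e hcov fun j => by
    rw [reassoc_of% hw j, ← H.map_comp, (hp j).w, reassoc_of% (hp j).w, H.map_comp,
      (D.p j).h_assoc, (f j).h]
  let W' : H.Coalgebra :=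
    { A := W
      a := w
      counit := hom_ext_of_cover e hcov fun j => by
        have h := H.ε.naturality (e j)
        dsimp only [Functor.id_map] at h
        rw [reassoc_of% hw j, h, (D.Y j).counit_assoc]
        exact (Category.comp_id _).symm
      coassoc := hom_ext_of_cover e hcov fun j => by
        have h := H.δ.naturality (e j)
        dsimp only [Functor.comp_map] at h
        rw [reassoc_of% hw j, reassoc_of% hw j, h, ← H.map_comp, hw j, H.map_comp,
          (D.Y j).coassoc_assoc] }
  refine ⟨W', ⟨q, hwq⟩, fun j => ⟨e j, (hw j).symm⟩, fun j => isPullback_of_f (hp j), ?_⟩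
  intro T i j y z h
  ext
  rw [Comonad.Coalgebra.comp_f, Comonad.Coalgebra.comp_f, ← D.trF_f]
  exact he _ _ _

end OverDescent

end CoalgebraDescent

/-! ### The stack condition and the main theorem -/

section Main

variable {E : Type u₁} [Category.{v₁} E] {F : Type u₂} [Category.{v₂} F] [HasFiniteLimits F]
  {i : E ⥤ F} {G : Comonad E} {H : Comonad F} (φ : ComonadMorphism i G H)

lemma ComonadMorphism.isStack_coalg [i.Full] [i.Faithful] [PreservesFiniteLimits H.toFunctor]
    [HasPullbacks H.Coalgebra] (h : SubobjectClosed i)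
    (hsite : IsMorphismOfSites i i H.toFunctor) [(inducedTopology i).Subcanonical]
    (hs : (selfIndexing F).IsStack (inducedTopology i)) :
    (selfIndexing H.Coalgebra).IsStack (inducedTopology φ.coalg) := by
  have := φ.isDense_coalg h hsite
  have := subcanonical_inducedTopology φ.coalg
  refine isStack_selfIndexing fun X S hS D => ?_
  have hS' : Sieve.ofArrows _ (fun g : S.arrows.category => g.obj.hom) ∈
      inducedTopology φ.coalg X := by
    rwa [Sieve.ofArrows_category', Sieve.generate_sieve]
  have hf := φ.ofArrows_f_mem h hsite hS'
  exact D.isEffective_of_forget hf (D.forgetDatum.isEffective_of_isStack hf)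

end Main

end StratTopos

theorem mainTheorem3 {E : Type u₁} [Category.{v₁} E] {F : Type u₂} [Category.{v₂} F]
    [StratTopos.IsElementaryTopos E] [StratTopos.IsElementaryTopos F]
    (G : Comonad E) (H : Comonad F) (i : E ⥤ F) (φ : StratTopos.ComonadMorphism i G H)
    (hφ : StratTopos.IsDenseLogicalComonadInclusion φ) :
    ∃ (_ : StratTopos.IsElementaryTopos G.Coalgebra)
      (_ : StratTopos.IsElementaryTopos H.Coalgebra),
      StratTopos.IsDenseLogicalInclusion φ.coalg := by
  have := hφ.cartesian_source
  have := hφ.cartesian_target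
  have hi := hφ.isDenseLogicalInclusion
  have := hi.full
  have := hi.faithful
  have := hi.preservesFiniteLimits
  have := hi.isDense
  have := StratTopos.subcanonical_inducedTopology i
  have hsub : StratTopos.SubobjectClosed i := hi.toIsLogicalInclusion.subobjectClosed
  have hsite := hφ.isMorphismOfSites
  have tG : StratTopos.IsElementaryTopos G.Coalgebra := StratTopos.isElementaryTopos_coalgebra
  have tH : StratTopos.IsElementaryTopos H.Coalgebra := StratTopos.isElementaryTopos_coalgebra
  have := φ.full_coalg
  have := φ.faithful_coalg
  have := φ.preservesFiniteLimits_coalg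
  have hdense := φ.isDense_coalg hsub hsite
  have := StratTopos.subcanonical_inducedTopology φ.coalg
  exact ⟨tG, tH,
    { full := inferInstance
      faithful := inferInstance
      injective_obj := φ.injective_obj_coalg hi.injective_obj
      preservesFiniteLimits := inferInstance
      isExponential := fun _ hev _ h => StratTopos.isExponential_map hev h
      classifier := StratTopos.exists_classifier (φ.subobjectClosed_coalg hsub)
      isDense := hdense
      isStack := φ.isStack_coalg hsub hsite hi.isStack }⟩
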